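/- **Theorem 1.4 (Uniform Poincaré inequality for the one-particle marginal).** For $N\ge 1$ let $D_N=\{x=(x_1,\dots,x_N)\in(\mathbb R^2)^N: x_i\ne x_j \text{ for } i\ne j\}$, and for $x\in D_N$ let $$H(x)=\frac1N\sum_{i=1}^N|x_i|^2+\frac1{2N^2}\sum_{1\le i\ne j\le N}\log\frac1{|x_i-x_j|^2}.$$ For $\beta_N=N^2$ (the complex Ginibre ensemble), let $P^N$ be the probability measure on $(\mathbb R^2)^N$ with density $Z_N^{-1}e^{-\beta_N H}$ on $D_N$ and $0$ off $D_N$, where $Z_N=\int_{D_N}e^{-\beta_N H(x)}\,dx$, and let $P^{1,N}$ be the law on $\mathbb R^2$ of $x_1$ under $P^N$. A probability measure $\mu$ on a Euclidean space satisfies the Poincaré inequality on a class $\mathcal F$ of smooth functions with constant $c\in(0,\infty)$ if $\mathrm{Var}_\mu(f)\le c\,\mathbb E_\mu(|\nabla f|^2)$ for every $f\in\mathcal F$. Here $\nabla$ and $|\cdot|$ are Euclidean, both sides take values in $[0,\infty]$, and $\mathrm{Var}_\mu(f)=\infty$ if $f\notin L^2(\mu)$. 1. There is a constant $c\in(0,\infty)$,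 independent of $N$, such that for every $N\ge1$ the measure $P^{1,N}$ satisfies the Poincaré inequality on $\mathcal C^\infty(\mathbb R^2)$ with constant $c$. 2. There is a constant $c_0>0$, independent of $N$, such that for every $N\ge1$ the smallest constant in the Poincaré inequality for $P^N$ on the class of $\mathcal C^\infty$ functions with compact support included in $D_N$, that is, the infimum in $[0,\infty]$ of the admissible constants, is at least $c_0$. -/

import Mathlib

open MeasureTheory
open scoped ENNReal NNReal

noncomputable section

namespace CoulombGas

/-- The Euclidean plane `ℝ²`. -/
abbrev Plane : Type := EuclideanSpace ℝ (Fin 2)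

/-- The space `(ℝ²)^N` of `N`-tuples of points of the plane, with the Euclidean norm
`|x|² = ∑ i, |x i|²`. Its `volume` is the Lebesgue measure `dx₁ ⋯ dx_N`. -/
abbrev Config (N : ℕ) : Type := PiLp 2 (fun _ : Fin N => Plane)

/-- The set `D` of configurations of pairwise distinct points. -/
def distinctConfigs (N : ℕ) : Set (Config N) :=
  {x | ∀ i j : Fin N, i ≠ j → x i ≠ x j}

/-- The confinement potential `V(z) = |z|²`. -/
def confinement (z : Plane) : ℝ := ‖z‖ ^ 2

/-- The pair interaction `W(z) = log (1 / |z|²)`, for `z ≠ 0`. -/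
def interaction (z : Plane) : ℝ := Real.log (1 / ‖z‖ ^ 2)

/-- The energy
`H(x) = (1/N) ∑ i, V(x i) + (1/(2N²)) ∑ i ≠ j, W(x i - x j)`, meaningful on `D`. -/
def energy (N : ℕ) (x : Config N) : ℝ :=
  (1 / (N : ℝ)) * ∑ i, confinement (x i) +
    (1 / (2 * (N : ℝ) ^ 2)) * ∑ i, ∑ j, if i ≠ j then interaction (x i - x j) else 0

/-- The measure on `(ℝ²)^N` with density `exp (-β H)` on `D` and `0` off `D`. -/
def gibbsWeight (N : ℕ) (β : ℝ) : Measure (Config N) :=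
  (volume.restrict (distinctConfigs N)).withDensity
    fun x => ENNReal.ofReal (Real.exp (-β * energy N x))

/-- The partition function `Z = ∫_D exp (-β H(x)) dx`. -/
def partitionFunction (N : ℕ) (β : ℝ) : ℝ≥0∞ :=
  ∫⁻ x in distinctConfigs N, ENNReal.ofReal (Real.exp (-β * energy N x))

/-- The Boltzmann-Gibbs measure `P^N` at inverse temperature `β`: the measure on `(ℝ²)^N` with
density `exp (-β H) / Z` on `D` and `0` off `D`. -/
def gibbsMeasure (N : ℕ) (β : ℝ) : Measure (Config N) :=
  (partitionFunction N β)⁻¹ • gibbsWeight N β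

/-- The one-particle marginal `P^{1,N}`: the law on `ℝ²` of the first particle under `P^N`. -/
def oneParticleMarginal (N : ℕ) [NeZero N] (β : ℝ) : Measure Plane :=
  (gibbsMeasure N β).map fun x => x 0

/-- The measure `μ` satisfies the Poincaré inequality on the class of functions `F` with
constant `c > 0`: `Var_μ(f) ≤ c E_μ(|∇f|²)` for every `f ∈ F`.
Both sides are `[0,∞]`-valued; for a probability measure `μ`, the variance `evariance f μ` is the
usual one if `f ∈ L²(μ)`, and it is `∞` otherwise. -/
def PoincareInequality {E : Type*} [NormedAddCommGroup E] [InnerProductSpace ℝ E] [CompleteSpace E]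
    [MeasurableSpace E] (μ : Measure E) (F : Set (E → ℝ)) (c : ℝ≥0) : Prop :=
  0 < c ∧ ∀ f ∈ F, ProbabilityTheory.evariance f μ ≤ c * ∫⁻ x, ‖gradient f x‖ₑ ^ 2 ∂μ

/-- The smallest constant in the Poincaré inequality for `μ` on `F`, in `[0,∞]` (it is `∞` if no
finite constant is admissible). -/
def bestPoincareConstant {E : Type*} [NormedAddCommGroup E] [InnerProductSpace ℝ E]
    [CompleteSpace E] [MeasurableSpace E] (μ : Measure E) (F : Set (E → ℝ)) : ℝ≥0∞ :=
  ⨅ (c : ℝ≥0) (_ : PoincareInequality μ F c), (c : ℝ≥0∞)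

/-- All smooth (`C^∞`) functions on `E`. -/
def smoothFunctions (E : Type*) [NormedAddCommGroup E] [NormedSpace ℝ E] : Set (E → ℝ) :=
  {f | ContDiff ℝ (⊤ : ℕ∞) f}

/-- The smooth functions with compact support included in `S` (extended by zero off `S`). -/
def smoothCompactlySupportedIn {E : Type*} [NormedAddCommGroup E] [NormedSpace ℝ E] (S : Set E) :
    Set (E → ℝ) :=
  {f | ContDiff ℝ (⊤ : ℕ∞) f ∧ HasCompactSupport f ∧ tsupport f ⊆ S}

end CoulombGas

end

/-! For `β = N²` the Gibbs density is `e^{-N|x|²}` times the squared modulus of a Vandermonde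
determinant. Expand the determinant and its conjugate over pairs of permutations and integrate out
all particles but one: orthogonality of the monomials `z^l` for the Gaussian weight kills every pair
of distinct permutations (`exists_setIntegral_ginibreDensity`). The marginal therefore has density
`π⁻¹ g(|z|²)`, where `g(s)` is the probability that a Poisson variable of mean `N s` is less than
`N`. Uniformly in `N`, this `g` is nonincreasing with values in `[0, 1]`, is at least `1/2` on `[0,
1/2]`, and satisfies `g' ≤ -g/2` on `[2, ∞)`.

These properties alone (`IsRadialProfile`) give a Poincaré inequality, by a Lyapunov argument. The
field `x k(|x|²) g(|x|²)`, with `k = fieldFactor`, has divergence at most `-g/250` outside the disc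
of radius `1/2` and is controlled inside. Integrating the divergence of the field times `F²` over
large boxes bounds `∫ F² g` by a gradient term plus the integral of `F²` over the disc
(`lintegral_box_le`). After subtraction of a constant, that last integral is bounded by the
elementary Poincaré inequality on a square where `g ≥ 1/2`.

For the lower bound the test function is the first coordinate of the first particle. Its gradient
has norm at most `1`, and its variance is bounded below because the marginal density is at least
`1/(2π)` on a fixed square. It lacks compact support off the collisions, so it is multiplied by
cutoffs in `|V|²` (`V` the Vandermonde determinant) and in `|x|²`. The weight `|V|²` compensates the
large gradient of the cutoff near collisions, which gives a bound uniform in the cutoff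
(`norm_fderiv_mul_smoothTransition_mul_le`). Dominated convergence for the energy and Fatou for the
variance then pass to the limit. -/

namespace CoulombGas

/-! ### Poisson distribution function and the radial profile -/

/-- The probability that a Poisson variable of mean `t` is less than `N`. -/
noncomputable def poissonCDF (N : ℕ) (t : ℝ) : ℝ :=
  Real.exp (-t) * ∑ l ∈ Finset.range N, t ^ l / (l.factorial : ℝ)

lemma poissonCDF_nonneg (N : ℕ) {t : ℝ} (ht : 0 ≤ t) : 0 ≤ poissonCDF N t := by
  unfold poissonCDF; positivity

lemma poissonCDF_le_one (N : ℕ) {t : ℝ} (ht : 0 ≤ t) : poissonCDF N t ≤ 1 := by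
  unfold poissonCDF
  rw [Real.exp_neg, inv_mul_le_iff₀ (Real.exp_pos t), mul_one]
  exact Real.sum_le_exp_of_nonneg ht N

lemma hasDerivAt_sum_pow_div_factorial (n : ℕ) (t : ℝ) :
    HasDerivAt (fun t : ℝ => ∑ l ∈ Finset.range (n + 1), t ^ l / (l.factorial : ℝ))
      (∑ l ∈ Finset.range n, t ^ l / (l.factorial : ℝ)) t := by
  induction n with
  | zero => simpa using hasDerivAt_const t (1 : ℝ)
  | succ n ih =>
    have h : HasDerivAt (fun t : ℝ => t ^ (n + 1) / ((n + 1).factorial : ℝ))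
        (t ^ n / (n.factorial : ℝ)) t := by
      convert! (hasDerivAt_pow (n + 1) t).div_const ((n + 1).factorial : ℝ) using 1
      rw [Nat.factorial_succ]
      have := Nat.factorial_ne_zero n
      push_cast
      field_simp
    have h2 := ih.add h
    rw [Finset.sum_range_succ]
    convert! h2 using 1
    ext t
    rw [Finset.sum_range_succ, Pi.add_apply]

lemma hasDerivAt_poissonCDF (n : ℕ) (t : ℝ) :
    HasDerivAt (poissonCDF (n + 1)) (-(Real.exp (-t) * (t ^ n / (n.factorial : ℝ)))) t := by
  have h := ((hasDerivAt_neg t).exp).mul (hasDerivAt_sum_pow_div_factorial n t)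
  convert! h using 1
  rw [Finset.sum_range_succ]
  ring

/-- Markov's inequality for a Poisson variable: the average of `1 - l/(n+1)` is `1 - t/(n+1)`.
Discarding the terms with `l > n`, which are nonpositive, and bounding the other factors by `1` can
only increase it. -/
lemma one_sub_div_le_poissonCDF (n : ℕ) {t : ℝ} (ht : 0 ≤ t) :
    1 - t / ((n : ℝ) + 1) ≤ poissonCDF (n + 1) t := by
  have hn : (0 : ℝ) < (n : ℝ) + 1 := by positivity
  have h0 : HasSum (fun l : ℕ => t ^ l / (l.factorial : ℝ)) (Real.exp t) := by
    rw [Real.exp_eq_exp_ℝ]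
    exact NormedSpace.expSeries_div_hasSum_exp t
  have h1 : HasSum (fun l : ℕ => (l : ℝ) * (t ^ l / (l.factorial : ℝ))) (t * Real.exp t) := by
    rw [← hasSum_nat_add_iff' 1]
    simp only [Finset.range_one, Finset.sum_singleton, Nat.cast_zero, zero_mul, sub_zero]
    convert! h0.mul_left t using 1
    ext l
    have := Nat.factorial_ne_zero l
    rw [Nat.factorial_succ]
    push_cast
    field_simp
    ring
  have h2 : HasSum (fun l : ℕ => (1 - (l : ℝ) / (n + 1)) * (t ^ l / (l.factorial : ℝ)))
      ((1 - t / (n + 1)) * Real.exp t) := by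
    convert! h0.sub (h1.div_const ((n : ℝ) + 1)) using 1
    · ext l; ring
    · ring
  have h3 : (1 - t / (n + 1)) * Real.exp t ≤
      ∑ l ∈ Finset.range (n + 1), t ^ l / (l.factorial : ℝ) := by
    have h4 : (1 - t / (n + 1)) * Real.exp t ≤
        ∑ l ∈ Finset.range (n + 1), (1 - (l : ℝ) / (n + 1)) * (t ^ l / (l.factorial : ℝ)) := by
      refine hasSum_le_of_sum_le h2 fun s => ?_
      calc _ ≤ ∑ l ∈ s ∪ Finset.range (n + 1),
              if l < n + 1 then (1 - (l : ℝ) / (n + 1)) * (t ^ l / (l.factorial : ℝ)) else 0 := by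
            have hpos : ∀ l : ℕ, l < n + 1 → 0 ≤ 1 - (l : ℝ) / (n + 1) := fun l hl => by
              rw [sub_nonneg, div_le_one hn]; exact_mod_cast hl.le
            refine (Finset.sum_le_sum (g := fun l => if l < n + 1 then
              (1 - (l : ℝ) / (n + 1)) * (t ^ l / (l.factorial : ℝ)) else 0) fun l _ => ?_).trans
              (Finset.sum_le_sum_of_subset_of_nonneg Finset.subset_union_left fun l _ _ => ?_)
            · split_ifs with h
              · exact le_rfl
              · refine mul_nonpos_of_nonpos_of_nonneg ?_ (by positivity)
                rw [sub_nonpos, one_le_div hn]; exact_mod_cast not_lt.mp h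
            · split_ifs with h
              · exact mul_nonneg (hpos l h) (by positivity)
              · exact le_rfl
        _ = _ := by
            rw [← Finset.sum_filter]
            congr 1
            ext l
            simp only [Finset.mem_filter, Finset.mem_union, Finset.mem_range]
            tauto
    refine h4.trans (Finset.sum_le_sum fun l _ => ?_)
    refine mul_le_of_le_one_left (by positivity) ?_
    have : 0 ≤ (l : ℝ) / (n + 1) := by positivity
    linarith
  unfold poissonCDF
  rw [Real.exp_neg, ← div_eq_inv_mul, le_div_iff₀ (Real.exp_pos t)]
  exact h3

/-- When `t ≥ 2n`, each term up to index `n` is at least twice the previous one, so the last term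
dominates as in a geometric sum. -/
lemma sum_pow_div_factorial_le (n : ℕ) {t : ℝ} (ht : 2 * (n : ℝ) ≤ t) :
    ∑ l ∈ Finset.range (n + 1), t ^ l / (l.factorial : ℝ) ≤ 2 * (t ^ n / (n.factorial : ℝ)) := by
  induction n with
  | zero => simp
  | succ n ih =>
    push_cast at ht
    have ht0 : 0 ≤ t := le_trans (by positivity) ht
    rw [Finset.sum_range_succ]
    have h1 := ih (by linarith)
    have h2 : 2 * (t ^ n / (n.factorial : ℝ)) ≤ t ^ (n + 1) / ((n + 1).factorial : ℝ) := by
      have h3 : t ^ (n + 1) / ((n + 1).factorial : ℝ)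
          = (t / (n + 1)) * (t ^ n / (n.factorial : ℝ)) := by
        rw [Nat.factorial_succ]; push_cast
        have := Nat.factorial_ne_zero n
        field_simp
        ring
      rw [h3]
      refine mul_le_mul_of_nonneg_right ?_ (by positivity)
      rw [le_div_iff₀ (by positivity)]; linarith
    linarith

/-- The profile `s ↦ poissonCDF N (N s)` of the one-particle density. -/
noncomputable def profile (n : ℕ) (s : ℝ) : ℝ := poissonCDF (n + 1) (((n : ℝ) + 1) * s)

/-- The derivative of `profile n`. -/
noncomputable def profileDeriv (n : ℕ) (s : ℝ) : ℝ :=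
  -(Real.exp (-(((n : ℝ) + 1) * s)) * ((((n : ℝ) + 1) * s) ^ n / (n.factorial : ℝ)))
    * ((n : ℝ) + 1)

lemma hasDerivAt_profile (n : ℕ) (s : ℝ) : HasDerivAt (profile n) (profileDeriv n s) s := by
  have h := (hasDerivAt_poissonCDF n (((n : ℝ) + 1) * s)).comp s
    ((hasDerivAt_id s).const_mul ((n : ℝ) + 1))
  rw [mul_one] at h
  exact h

lemma continuous_profileDeriv (n : ℕ) : Continuous (profileDeriv n) := by
  unfold profileDeriv; fun_prop

lemma continuous_profile (n : ℕ) : Continuous (profile n) :=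
  continuous_iff_continuousAt.2 fun s => (hasDerivAt_profile n s).continuousAt

lemma profile_nonneg (n : ℕ) {s : ℝ} (hs : 0 ≤ s) : 0 ≤ profile n s :=
  poissonCDF_nonneg _ (by positivity)

lemma profile_le_one (n : ℕ) {s : ℝ} (hs : 0 ≤ s) : profile n s ≤ 1 :=
  poissonCDF_le_one _ (by positivity)

lemma half_le_profile (n : ℕ) {s : ℝ} (hs : 0 ≤ s) (hs' : s ≤ 1 / 2) : 1 / 2 ≤ profile n s := by
  have h := one_sub_div_le_poissonCDF n (t := ((n : ℝ) + 1) * s) (by positivity)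
  rw [mul_div_cancel_left₀ _ (by positivity)] at h
  unfold profile
  linarith

lemma profileDeriv_nonpos (n : ℕ) {s : ℝ} (hs : 0 ≤ s) : profileDeriv n s ≤ 0 := by
  unfold profileDeriv
  rw [neg_mul, neg_nonpos]
  positivity

lemma profileDeriv_le (n : ℕ) {s : ℝ} (hs : 2 ≤ s) : profileDeriv n s ≤ -(profile n s / 2) := by
  have hn : (0 : ℝ) ≤ n := by positivity
  have h := sum_pow_div_factorial_le n (t := ((n : ℝ) + 1) * s) (by nlinarith)
  unfold profileDeriv profile poissonCDF
  set E := Real.exp (-(((n : ℝ) + 1) * s))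
  have hE : 0 < E := Real.exp_pos _
  set A := (((n : ℝ) + 1) * s) ^ n / (n.factorial : ℝ)
  have hA : 0 ≤ A := by positivity
  have h1 := mul_le_mul_of_nonneg_left h hE.le
  have h2 : 0 ≤ E * A * n := by positivity
  linarith


/-! ### Poincaré inequality on a square -/

section Square

/-- The interval `[-1/2, 1/2]`. -/
abbrev unitInt : Set ℝ := Set.Icc (-(1 / 2)) (1 / 2)

/-- Fundamental theorem of calculus and Cauchy–Schwarz on an interval of length at most `1`. -/
lemma ofReal_sq_sub_le_lintegral_deriv {g g' : ℝ → ℝ} (hg : ∀ t, HasDerivAt g (g' t) t)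
    (hg' : Continuous g') {a b : ℝ} (ha : a ∈ unitInt) (hb : b ∈ unitInt) :
    ENNReal.ofReal ((g a - g b) ^ 2) ≤ ∫⁻ t in unitInt, ENNReal.ofReal (g' t ^ 2) := by
  wlog hab : b ≤ a generalizing a b
  · rw [show (g a - g b) ^ 2 = (g b - g a) ^ 2 by ring]
    exact this hb ha (le_of_not_ge hab)
  have h1 : ∫ t in b..a, g' t = g a - g b :=
    intervalIntegral.integral_eq_sub_of_hasDerivAt (fun t _ => hg t) (hg'.intervalIntegrable _ _)
  have h2 : (∫ t in b..a, g' t) ^ 2 ≤ ∫ t in b..a, g' t ^ 2 := by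
    have hc := hg'.intervalIntegrable (μ := volume) b a
    have hc2 : IntervalIntegrable (fun t => g' t ^ 2) volume b a :=
      (hg'.pow 2).intervalIntegrable _ _
    -- Cauchy–Schwarz comes from expanding `∫ (g' - m)² ≥ 0`, where `m` is the integral and not the
    -- mean; `a - b ≤ 1` is enough to conclude.
    set m := ∫ t in b..a, g' t
    have h3 : 0 ≤ ∫ t in b..a, (g' t - m) ^ 2 :=
      intervalIntegral.integral_nonneg hab fun _ _ => sq_nonneg _
    have h4 : ∫ t in b..a, (g' t - m) ^ 2 = (∫ t in b..a, g' t ^ 2) - 2 * m * m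
        + (a - b) * m ^ 2 := by
      have : ∀ t, (g' t - m) ^ 2 = g' t ^ 2 - 2 * m * g' t + m ^ 2 := fun t => by ring
      simp_rw [this]
      rw [intervalIntegral.integral_add (hc2.sub (hc.const_mul _)) (by simp),
        intervalIntegral.integral_sub hc2 (hc.const_mul _),
        intervalIntegral.integral_const_mul, intervalIntegral.integral_const, smul_eq_mul]
    have h5 : (a - b) * m ^ 2 ≤ m ^ 2 :=
      mul_le_of_le_one_left (sq_nonneg m) (by linarith [ha.2, hb.1])
    nlinarith
  rw [← h1]
  calc _ ≤ ENNReal.ofReal (∫ t in b..a, g' t ^ 2) := ENNReal.ofReal_le_ofReal h2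
    _ = ∫⁻ t in Set.Ioc b a, ENNReal.ofReal (g' t ^ 2) := by
      rw [intervalIntegral.integral_of_le hab, ofReal_integral_eq_lintegral_ofReal]
      · exact ((hg'.pow 2).intervalIntegrable b a).1
      · exact Filter.Eventually.of_forall fun t => sq_nonneg _
    _ ≤ _ := lintegral_mono_set (t := unitInt)
      fun t ht => ⟨hb.1.trans ht.1.le, ht.2.trans ha.2⟩

lemma volume_unitInt : volume unitInt = 1 := by
  rw [Real.volume_Icc]; norm_num

instance : IsProbabilityMeasure (volume.restrict unitInt) :=
  ⟨by rw [Measure.restrict_apply_univ, volume_unitInt]⟩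

/-- A Poincaré-type inequality on the square `[-1/2, 1/2]²`. -/
lemma exists_lintegral_square_le {F F₁ F₂ : ℝ × ℝ → ℝ} (hF : Continuous F)
    (h1 : ∀ x y, HasDerivAt (fun t => F (t, y)) (F₁ (x, y)) x)
    (h2 : ∀ x y, HasDerivAt (fun t => F (x, t)) (F₂ (x, y)) y)
    (hc1 : Continuous F₁) (hc2 : Continuous F₂) :
    ∃ m : ℝ, ∫⁻ p in unitInt ×ˢ unitInt, ENNReal.ofReal ((F p - m) ^ 2) ≤
      2 * ∫⁻ p in unitInt ×ˢ unitInt, ENNReal.ofReal (F₁ p ^ 2 + F₂ p ^ 2) := by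
  set ν := volume.restrict unitInt with hν
  have hνν : (volume : Measure (ℝ × ℝ)).restrict (unitInt ×ˢ unitInt) = ν.prod ν := by
    rw [Measure.volume_eq_prod, Measure.prod_restrict]
  rw [hνν]
  set I₁ := ∫⁻ p, ENNReal.ofReal (F₁ p ^ 2) ∂(ν.prod ν)
  set I₂ := ∫⁻ p, ENNReal.ofReal (F₂ p ^ 2) ∂(ν.prod ν)
  have hI : ∫⁻ p, ENNReal.ofReal (F₁ p ^ 2 + F₂ p ^ 2) ∂(ν.prod ν) = I₁ + I₂ := by
    rw [← lintegral_add_left (by fun_prop)]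
    exact lintegral_congr fun p => ENNReal.ofReal_add (sq_nonneg _) (sq_nonneg _)
  have hae : ∀ᵐ p ∂(ν.prod ν), p ∈ unitInt ×ˢ unitInt := by
    rw [← hνν]
    exact ae_restrict_mem (measurableSet_Icc.prod measurableSet_Icc)
  have key : ∫⁻ q, ∫⁻ p, ENNReal.ofReal ((F p - F q) ^ 2) ∂(ν.prod ν) ∂(ν.prod ν)
      ≤ 2 * (I₁ + I₂) := by
    calc _ ≤ ∫⁻ q, ∫⁻ p, 2 * ((∫⁻ u, ENNReal.ofReal (F₁ (u, p.2) ^ 2) ∂ν) +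
            ∫⁻ v, ENNReal.ofReal (F₂ (q.1, v) ^ 2) ∂ν) ∂(ν.prod ν) ∂(ν.prod ν) := by
          refine lintegral_mono_ae (hae.mono fun q hq => lintegral_mono_ae (hae.mono fun p hp => ?_))
          -- `p` and `q` are joined through the corner `(q.1, p.2)`, one coordinate direction at a
          -- time.
          have e1 := ofReal_sq_sub_le_lintegral_deriv (g := fun t => F (t, p.2))
            (g' := fun t => F₁ (t, p.2)) (fun t => h1 t _) (by fun_prop) hp.1 hq.1
          have e2 := ofReal_sq_sub_le_lintegral_deriv (g := fun t => F (q.1, t))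
            (g' := fun t => F₂ (q.1, t)) (fun t => h2 _ t) (by fun_prop) hp.2 hq.2
          refine le_trans ?_ (mul_le_mul_right (add_le_add e1 e2) 2)
          rw [← ENNReal.ofReal_add (sq_nonneg _) (sq_nonneg _),
            show (2 : ℝ≥0∞) = ENNReal.ofReal 2 by simp, ← ENNReal.ofReal_mul (by norm_num)]
          refine ENNReal.ofReal_le_ofReal ?_
          have := sq_nonneg ((F (p.1, p.2) - F (q.1, p.2)) - (F (q.1, p.2) - F (q.1, q.2)))
          simp only [Prod.mk.eta] at *
          nlinarith
      _ = 2 * (I₁ + I₂) := by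
          have m1 : Measurable fun y => ∫⁻ u, ENNReal.ofReal (F₁ (u, y) ^ 2) ∂ν :=
            Measurable.lintegral_prod_left' (f := fun p : ℝ × ℝ => ENNReal.ofReal (F₁ p ^ 2))
              (by fun_prop)
          have m2 : Measurable fun x => ∫⁻ v, ENNReal.ofReal (F₂ (x, v) ^ 2) ∂ν :=
            Measurable.lintegral_prod_right' (f := fun p : ℝ × ℝ => ENNReal.ofReal (F₂ p ^ 2))
              (by fun_prop)
          have k1 : ∫⁻ p, ∫⁻ u, ENNReal.ofReal (F₁ (u, p.2) ^ 2) ∂ν ∂(ν.prod ν) = I₁ := by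
            rw [lintegral_prod (fun p => ∫⁻ u, ENNReal.ofReal (F₁ (u, p.2) ^ 2) ∂ν)
              (m1.comp measurable_snd).aemeasurable]
            simp only [lintegral_const, measure_univ, mul_one]
            exact (lintegral_prod_symm (fun p => ENNReal.ofReal (F₁ p ^ 2))
              (show Measurable fun p => ENNReal.ofReal (F₁ p ^ 2) by fun_prop).aemeasurable).symm
          have k2 : ∫⁻ q, ∫⁻ v, ENNReal.ofReal (F₂ (q.1, v) ^ 2) ∂ν ∂(ν.prod ν) = I₂ := by
            rw [lintegral_prod (fun q => ∫⁻ v, ENNReal.ofReal (F₂ (q.1, v) ^ 2) ∂ν)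
              (m2.comp measurable_fst).aemeasurable]
            simp only [lintegral_const, measure_univ, mul_one]
            exact (lintegral_prod (fun p => ENNReal.ofReal (F₂ p ^ 2))
              (show Measurable fun p => ENNReal.ofReal (F₂ p ^ 2) by fun_prop).aemeasurable).symm
          have k3 : ∀ q : ℝ × ℝ, ∫⁻ p, 2 * ((∫⁻ u, ENNReal.ofReal (F₁ (u, p.2) ^ 2) ∂ν) +
            ∫⁻ v, ENNReal.ofReal (F₂ (q.1, v) ^ 2) ∂ν) ∂(ν.prod ν) =
              2 * (I₁ + ∫⁻ v, ENNReal.ofReal (F₂ (q.1, v) ^ 2) ∂ν) := fun q => by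
            rw [lintegral_const_mul _ (by fun_prop), lintegral_add_left (by fun_prop), k1]
            simp
          simp_rw [k3]
          rw [lintegral_const_mul _ (by fun_prop), lintegral_add_left (by fun_prop), k2]
          simp
  -- Some `q` does at least as well as the average over `q`; the constant is then `F q`, so no
  -- integrability of `F` or mean value is needed.
  obtain ⟨q, hq⟩ := exists_le_lintegral (μ := ν.prod ν)
    (f := fun q => ∫⁻ p, ENNReal.ofReal ((F p - F q) ^ 2) ∂(ν.prod ν)) (by
      refine (Measurable.lintegral_prod_left' (f := fun z : (ℝ × ℝ) × (ℝ × ℝ) =>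
        ENNReal.ofReal ((F z.1 - F z.2) ^ 2)) (by fun_prop)).aemeasurable)
  exact ⟨F q, by rw [hI]; exact hq.trans key⟩

end Square

/-! ### Weighted Poincaré inequality from a Lyapunov vector field -/

section Divergence

/-- The radial factor of the vector field `x ↦ x k(|x|²)`. -/
noncomputable def fieldFactor (s : ℝ) : ℝ := (s + 1) / (s ^ 2 + 1 / 64)

/-- The derivative of `fieldFactor`. -/
noncomputable def fieldFactorDeriv (s : ℝ) : ℝ :=
  ((s ^ 2 + 1 / 64) - (s + 1) * (2 * s)) / (s ^ 2 + 1 / 64) ^ 2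

lemma hasDerivAt_fieldFactor (s : ℝ) : HasDerivAt fieldFactor (fieldFactorDeriv s) s := by
  have h : HasDerivAt (fun s : ℝ => s + 1) 1 s := (hasDerivAt_id s).add_const 1
  have h2 : HasDerivAt (fun s : ℝ => s ^ 2 + 1 / 64) (2 * s) s := by
    simpa using (hasDerivAt_pow 2 s).add_const (1 / 64 : ℝ)
  have h0 : s ^ 2 + 1 / 64 ≠ 0 := by positivity
  convert! h.div h2 h0 using 1
  rw [fieldFactorDeriv, one_mul]

lemma continuous_fieldFactorDeriv : Continuous fieldFactorDeriv := by
  unfold fieldFactorDeriv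
  refine Continuous.div (by fun_prop) (by fun_prop) fun s => by positivity

lemma fieldFactor_nonneg {s : ℝ} (hs : 0 ≤ s) : 0 ≤ fieldFactor s := by
  unfold fieldFactor; positivity

lemma mul_fieldFactor_sq_le {s : ℝ} (hs : 0 ≤ s) : s * fieldFactor s ^ 2 ≤ 16384 := by
  unfold fieldFactor
  rw [div_pow, mul_div_assoc', div_le_iff₀ (by positivity)]
  rcases le_total s 1 with h | h
  · have h1 : s * (s + 1) ^ 2 ≤ 1 * (1 + 1) ^ 2 := by gcongr
    nlinarith [sq_nonneg s, sq_nonneg (s ^ 2)]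
  · have h1 : s * (s + 1) ^ 2 ≤ s * (s + s) ^ 2 := by gcongr
    have h2 : s ^ 3 * 1 ≤ s ^ 3 * s := by gcongr
    nlinarith [sq_nonneg s, sq_nonneg (s ^ 2), pow_pos (lt_of_lt_of_le one_pos h) 3]

lemma field_div_eq {s : ℝ} : fieldFactor s + s * fieldFactorDeriv s =
    (s / 32 + 1 / 64 - s ^ 2) / (s ^ 2 + 1 / 64) ^ 2 := by
  unfold fieldFactor fieldFactorDeriv
  have h0 : s ^ 2 + 1 / 64 ≠ 0 := by positivity
  rw [div_add' _ _ _ h0, div_eq_div_iff h0 (by positivity)]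
  field_simp
  ring

/-- A decreasing profile `g`, with derivative `g'`, bounded below near the origin and decaying
exponentially away from it. -/
structure IsRadialProfile (g g' : ℝ → ℝ) : Prop where
  hasDerivAt : ∀ s, HasDerivAt g (g' s) s
  continuous_deriv : Continuous g'
  nonneg : ∀ s, 0 ≤ s → 0 ≤ g s
  le_one : ∀ s, 0 ≤ s → g s ≤ 1
  half_le : ∀ s, 0 ≤ s → s ≤ 1 / 2 → 1 / 2 ≤ g s
  deriv_nonpos : ∀ s, 0 ≤ s → g' s ≤ 0
  deriv_le : ∀ s, 2 ≤ s → g' s ≤ -(g s / 2)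

lemma IsRadialProfile.continuous {g g' : ℝ → ℝ} (hg : IsRadialProfile g g') : Continuous g :=
  continuous_iff_continuousAt.2 fun s => (hg.hasDerivAt s).continuousAt

/-- In the plane the divergence of `x h(|x|²)` is `2 (s h(s))'` at `s = |x|²`, so the left side is
the divergence of `x k g` for `k = fieldFactor`. The function `s k(s) = (s² + s)/(s² + 1/64)`
decreases to `1` on `[1/4, ∞)`. Its slope is at most `-1/500` on `[1/4, 2]`; beyond `2` the slope
degenerates, but there `s k(s) ≥ 1` and `g' ≤ -g/2` suffice. On `[0, 1/4]` the slope is at most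
`96`, and `193` exceeds `2 · 96 + 1/250`. -/
lemma IsRadialProfile.field_div_le {g g' : ℝ → ℝ} (hg : IsRadialProfile g g') {s : ℝ}
    (hs : 0 ≤ s) :
    2 * ((fieldFactor s + s * fieldFactorDeriv s) * g s + s * fieldFactor s * g' s) ≤
      (-(1 / 250) + if s ≤ 1 / 4 then 193 else 0) * g s := by
  have hg0 := hg.nonneg s hs
  have hd := hg.deriv_nonpos s hs
  have hk : 0 ≤ s * fieldFactor s := mul_nonneg hs (fieldFactor_nonneg hs)
  have hkd : s * fieldFactor s * g' s ≤ 0 := mul_nonpos_of_nonneg_of_nonpos hk hd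
  rw [field_div_eq]
  set p' := (s / 32 + 1 / 64 - s ^ 2) / (s ^ 2 + 1 / 64) ^ 2 with hp'
  split_ifs with h4
  · have : p' ≤ 96 := by
      rw [hp', div_le_iff₀ (by positivity)]
      nlinarith [sq_nonneg s, sq_nonneg (s ^ 2)]
    nlinarith [mul_le_mul_of_nonneg_right this hg0]
  · push Not at h4
    rcases le_total s 2 with h2 | h2
    · have : p' ≤ -(1 / 500) := by
        rw [hp', div_le_iff₀ (by positivity)]
        have h5 : (s ^ 2 + 1 / 64) ^ 2 ≤ (2 ^ 2 + 1 / 64) ^ 2 := by gcongr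
        nlinarith
      nlinarith [mul_le_mul_of_nonneg_right this hg0]
    · have h6 : p' ≤ 0 := by
        refine div_nonpos_of_nonpos_of_nonneg (by nlinarith) (by positivity)
      have h7 : 1 ≤ s * fieldFactor s := by
        unfold fieldFactor
        rw [mul_div_assoc', le_div_iff₀ (by positivity)]
        nlinarith
      have h8 := hg.deriv_le s h2
      have h9 : s * fieldFactor s * g' s ≤ 1 * g' s := mul_le_mul_of_nonpos_right h7 hd
      have h10 := mul_le_mul_of_nonneg_right h6 hg0
      nlinarith

/-- The divergence theorem is applied to `x k g F²`. The flux through the boundary of the box is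
outward, hence nonnegative, so it can be dropped without any growth condition on `F`; this is why
the bound is uniform in `R`. -/
lemma IsRadialProfile.lintegral_box_le {g g' : ℝ → ℝ} (hg : IsRadialProfile g g')
    {F F₁ F₂ : ℝ × ℝ → ℝ} (hF : ∀ p, HasFDerivAt F
      (F₁ p • ContinuousLinearMap.fst ℝ ℝ ℝ + F₂ p • ContinuousLinearMap.snd ℝ ℝ ℝ) p)
    (hc1 : Continuous F₁) (hc2 : Continuous F₂) {R : ℝ} (hR : 0 ≤ R) :
    ∫⁻ p in Set.Icc (-R, -R) (R, R), ENNReal.ofReal (F p ^ 2 * g (p.1 ^ 2 + p.2 ^ 2)) ≤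
      500 * ∫⁻ p, ENNReal.ofReal ((if p.1 ^ 2 + p.2 ^ 2 ≤ 1 / 4 then 193 else 0) * F p ^ 2 +
        8192000 * ((F₁ p ^ 2 + F₂ p ^ 2) * g (p.1 ^ 2 + p.2 ^ 2))) := by
  have hFc : Continuous F := continuous_iff_continuousAt.2 fun p => (hF p).continuousAt
  have hgc := hg.continuous
  have hgc' := hg.continuous_deriv
  have hkc : Continuous fieldFactor :=
    continuous_iff_continuousAt.2 fun s => (hasDerivAt_fieldFactor s).continuousAt
  have hkc' := continuous_fieldFactorDeriv
  set G : ℝ → ℝ := fun s => fieldFactor s * g s with hG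
  set G' : ℝ → ℝ := fun s => fieldFactorDeriv s * g s + fieldFactor s * g' s with hG'
  have hGd : ∀ s, HasDerivAt G (G' s) s := fun s => (hasDerivAt_fieldFactor s).mul (hg.hasDerivAt s)
  have hGc : Continuous G := by fun_prop
  have hGc' : Continuous G' := by fun_prop
  have hGn : ∀ x y : ℝ, 0 ≤ G (x ^ 2 + y ^ 2) := fun x y =>
    mul_nonneg (fieldFactor_nonneg (by positivity)) (hg.nonneg _ (by positivity))
  set U : ℝ × ℝ → ℝ := fun p => G (p.1 ^ 2 + p.2 ^ 2) * F p ^ 2 with hU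
  set L : ℝ × ℝ → (ℝ × ℝ →L[ℝ] ℝ) := fun p =>
    G (p.1 ^ 2 + p.2 ^ 2) • ((2 * F p) • (F₁ p • ContinuousLinearMap.fst ℝ ℝ ℝ
      + F₂ p • ContinuousLinearMap.snd ℝ ℝ ℝ)) +
    F p ^ 2 • (G' (p.1 ^ 2 + p.2 ^ 2) • ((2 * p.1) • ContinuousLinearMap.fst ℝ ℝ ℝ +
      (2 * p.2) • ContinuousLinearMap.snd ℝ ℝ ℝ)) with hL
  have hUd : ∀ p, HasFDerivAt U (L p) p := by
    intro p
    have a1 : HasFDerivAt (fun p : ℝ × ℝ => p.1 ^ 2 + p.2 ^ 2)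
        ((2 * p.1) • ContinuousLinearMap.fst ℝ ℝ ℝ +
          (2 * p.2) • ContinuousLinearMap.snd ℝ ℝ ℝ) p := by
      convert! ((hasFDerivAt_fst (𝕜 := ℝ) (p := p)).pow 2).add
        ((hasFDerivAt_snd (𝕜 := ℝ) (p := p)).pow 2) using 1
      simp
    have a2 := (hGd (p.1 ^ 2 + p.2 ^ 2)).comp_hasFDerivAt p a1
    have a3 : HasFDerivAt (fun p => F p ^ 2) ((2 * F p) • (F₁ p • ContinuousLinearMap.fst ℝ ℝ ℝ
      + F₂ p • ContinuousLinearMap.snd ℝ ℝ ℝ)) p := by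
      convert! (hF p).pow 2 using 1
      simp
    exact a2.mul a3
  have hUc : Continuous U := by fun_prop
  set D : ℝ × ℝ → ℝ := fun p =>
    2 * ((fieldFactor (p.1 ^ 2 + p.2 ^ 2) +
      (p.1 ^ 2 + p.2 ^ 2) * fieldFactorDeriv (p.1 ^ 2 + p.2 ^ 2)) * g (p.1 ^ 2 + p.2 ^ 2) +
      (p.1 ^ 2 + p.2 ^ 2) * fieldFactor (p.1 ^ 2 + p.2 ^ 2) * g' (p.1 ^ 2 + p.2 ^ 2)) * F p ^ 2 +
    2 * F p * (fieldFactor (p.1 ^ 2 + p.2 ^ 2) * (p.1 * F₁ p + p.2 * F₂ p)) *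
      g (p.1 ^ 2 + p.2 ^ 2) with hD
  have hDc : Continuous D := by fun_prop
  set f' : ℝ × ℝ → (ℝ × ℝ →L[ℝ] ℝ) := fun p =>
    p.1 • L p + U p • ContinuousLinearMap.fst ℝ ℝ ℝ with hf'
  set h' : ℝ × ℝ → (ℝ × ℝ →L[ℝ] ℝ) := fun p =>
    p.2 • L p + U p • ContinuousLinearMap.snd ℝ ℝ ℝ with hh'
  -- `D` is the divergence of `x U(x)`, with `U = k g F²`.
  have hDeq : ∀ p, f' p (1, 0) + h' p (0, 1) = D p := by
    intro p
    simp [hf', hh', hL, hU, hD, hG, hG']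
    ring
  have hpos : 0 ≤ ∫ p in Set.Icc (-R, -R) (R, R), D p := by
    have hdiv := integral_divergence_prod_Icc_of_hasFDerivAt_of_le
      (fun p => p.1 * U p) (fun p => p.2 * U p) f' h' (-R, -R) (R, R)
      (by constructor <;> simpa using hR) (by fun_prop) (by fun_prop)
      (fun p _ => hasFDerivAt_fst.mul (hUd p)) (fun p _ => hasFDerivAt_snd.mul (hUd p))
      (by simp_rw [hDeq]; exact hDc.continuousOn.integrableOn_compact isCompact_Icc)
    simp_rw [hDeq] at hdiv
    rw [hdiv]
    have hRR : -R ≤ R := by linarith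
    have b1 : 0 ≤ ∫ x in (-R)..R, R * U (x, R) := intervalIntegral.integral_nonneg hRR fun x _ =>
      mul_nonneg hR (mul_nonneg (hGn _ _) (sq_nonneg _))
    have b2 : 0 ≤ ∫ x in (-R)..R, R * U (x, -R) := intervalIntegral.integral_nonneg hRR fun x _ =>
      mul_nonneg hR (mul_nonneg (hGn _ _) (sq_nonneg _))
    have b3 : 0 ≤ ∫ x in (-R)..R, R * U (R, x) := intervalIntegral.integral_nonneg hRR fun x _ =>
      mul_nonneg hR (mul_nonneg (hGn _ _) (sq_nonneg _))
    have b4 : 0 ≤ ∫ x in (-R)..R, R * U (-R, x) := intervalIntegral.integral_nonneg hRR fun x _ =>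
      mul_nonneg hR (mul_nonneg (hGn _ _) (sq_nonneg _))
    simp only [neg_mul, intervalIntegral.integral_neg]
    linarith
  set H : ℝ × ℝ → ℝ := fun p => F p ^ 2 * g (p.1 ^ 2 + p.2 ^ 2) / 500 with hH
  have hHc : Continuous H := by fun_prop
  have hpt : ∀ p, D p + H p ≤ (if p.1 ^ 2 + p.2 ^ 2 ≤ 1 / 4 then 193 else 0) * F p ^ 2 +
        8192000 * ((F₁ p ^ 2 + F₂ p ^ 2) * g (p.1 ^ 2 + p.2 ^ 2)) := by
    intro p
    have hs : 0 ≤ p.1 ^ 2 + p.2 ^ 2 := by positivity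
    have c1 := mul_le_mul_of_nonneg_right (hg.field_div_le hs) (sq_nonneg (F p))
    -- Young's inequality `2ab ≤ a²/500 + 500 b²`, with `8192000 = 500 · 16384`. It spends half of
    -- the gain `1/250`; the other half is `H`.
    have c2 : 2 * F p * (fieldFactor (p.1 ^ 2 + p.2 ^ 2) * (p.1 * F₁ p + p.2 * F₂ p)) ≤
        F p ^ 2 / 500 + 8192000 * (F₁ p ^ 2 + F₂ p ^ 2) := by
      have d1 := mul_fieldFactor_sq_le hs
      set k := fieldFactor (p.1 ^ 2 + p.2 ^ 2)
      have d2 : (k * (p.1 * F₁ p + p.2 * F₂ p)) ^ 2 ≤ 16384 * (F₁ p ^ 2 + F₂ p ^ 2) := by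
        refine le_trans ?_ (mul_le_mul_of_nonneg_right d1 (by positivity))
        nlinarith [sq_nonneg (k * (p.1 * F₂ p - p.2 * F₁ p))]
      nlinarith [sq_nonneg (F p / 500 - k * (p.1 * F₁ p + p.2 * F₂ p))]
    have c3 := mul_le_mul_of_nonneg_right c2 (hg.nonneg _ hs)
    have c4 : (if p.1 ^ 2 + p.2 ^ 2 ≤ 1 / 4 then (193 : ℝ) else 0) * g (p.1 ^ 2 + p.2 ^ 2) ≤
        if p.1 ^ 2 + p.2 ^ 2 ≤ 1 / 4 then (193 : ℝ) else 0 :=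
      mul_le_of_le_one_right (by split_ifs <;> norm_num) (hg.le_one _ hs)
    have c5 := mul_le_mul_of_nonneg_right c4 (sq_nonneg (F p))
    simp only [hD, hH]
    nlinarith
  have hDi : IntegrableOn D (Set.Icc (-R, -R) (R, R)) :=
    hDc.continuousOn.integrableOn_compact isCompact_Icc
  have hHi : IntegrableOn H (Set.Icc (-R, -R) (R, R)) :=
    hHc.continuousOn.integrableOn_compact isCompact_Icc
  have hHn : ∀ p, 0 ≤ H p := fun p =>
    div_nonneg (mul_nonneg (sq_nonneg _) (hg.nonneg _ (by positivity))) (by norm_num)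
  have hH1 : ∫⁻ p in Set.Icc (-R, -R) (R, R), ENNReal.ofReal (H p) ≤
      ∫⁻ p, ENNReal.ofReal ((if p.1 ^ 2 + p.2 ^ 2 ≤ 1 / 4 then 193 else 0) * F p ^ 2 +
        8192000 * ((F₁ p ^ 2 + F₂ p ^ 2) * g (p.1 ^ 2 + p.2 ^ 2))) := by
    calc _ = ENNReal.ofReal (∫ p in Set.Icc (-R, -R) (R, R), H p) :=
          (ofReal_integral_eq_lintegral_ofReal hHi (Filter.Eventually.of_forall hHn)).symm
      _ ≤ ENNReal.ofReal (∫ p in Set.Icc (-R, -R) (R, R), (D p + H p)) := by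
          rw [integral_add hDi hHi]
          exact ENNReal.ofReal_le_ofReal (by linarith)
      -- `D + H` may change sign: its integral is at most that of its positive part.
      _ ≤ ∫⁻ p in Set.Icc (-R, -R) (R, R), ENNReal.ofReal (D p + H p) := by
          rw [integral_eq_lintegral_pos_part_sub_lintegral_neg_part
            (f := fun p => D p + H p) (hDi.add hHi)]
          exact (ENNReal.ofReal_le_ofReal (sub_le_self _ ENNReal.toReal_nonneg)).trans
            ENNReal.ofReal_toReal_le
      _ ≤ _ := (lintegral_mono fun p => ENNReal.ofReal_le_ofReal (hpt p)).trans
            (setLIntegral_le_lintegral _ _)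
  have hH2 : ∀ p, ENNReal.ofReal (F p ^ 2 * g (p.1 ^ 2 + p.2 ^ 2)) =
      500 * ENNReal.ofReal (H p) := fun p => by
    rw [show (500 : ℝ≥0∞) = ENNReal.ofReal 500 by simp, ← ENNReal.ofReal_mul (by norm_num), hH]
    congr 1
    ring
  simp_rw [hH2]
  rw [lintegral_const_mul _ (by fun_prop)]
  exact mul_le_mul_right hH1 500

/-- A Poincaré inequality for the weight `g(|x|²)`. -/
theorem IsRadialProfile.exists_lintegral_le {g g' : ℝ → ℝ} (hg : IsRadialProfile g g')
    {F F₁ F₂ : ℝ × ℝ → ℝ} (hF : ∀ p, HasFDerivAt F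
      (F₁ p • ContinuousLinearMap.fst ℝ ℝ ℝ + F₂ p • ContinuousLinearMap.snd ℝ ℝ ℝ) p)
    (hc1 : Continuous F₁) (hc2 : Continuous F₂) :
    ∃ m : ℝ, ∫⁻ p, ENNReal.ofReal ((F p - m) ^ 2 * g (p.1 ^ 2 + p.2 ^ 2)) ≤
      4096386000 * ∫⁻ p, ENNReal.ofReal ((F₁ p ^ 2 + F₂ p ^ 2) * g (p.1 ^ 2 + p.2 ^ 2)) := by
  have hFc : Continuous F := continuous_iff_continuousAt.2 fun p => (hF p).continuousAt
  have hgc := hg.continuous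
  -- The square contains the disc `|x|² ≤ 1/4` and lies in `|x|² ≤ 1/2`, where `g ≥ 1/2`. The final
  -- constant is `500 · (193 · 4 + 8192000)`.
  obtain ⟨m, hm⟩ := exists_lintegral_square_le hFc
    (fun x y => by
      have := (hF (x, y)).comp_hasDerivAt x ((hasDerivAt_id x).prodMk (hasDerivAt_const x y))
      simpa [Function.comp_def] using this)
    (fun x y => by
      have := (hF (x, y)).comp_hasDerivAt y ((hasDerivAt_const y x).prodMk (hasDerivAt_id y))
      simpa [Function.comp_def] using this) hc1 hc2
  refine ⟨m, ?_⟩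
  set J := ∫⁻ p, ENNReal.ofReal ((F₁ p ^ 2 + F₂ p ^ 2) * g (p.1 ^ 2 + p.2 ^ 2))
  have hsq : ∫⁻ p in unitInt ×ˢ unitInt, ENNReal.ofReal (F₁ p ^ 2 + F₂ p ^ 2) ≤ 2 * J := by
    calc _ ≤ ∫⁻ p in unitInt ×ˢ unitInt,
          2 * ENNReal.ofReal ((F₁ p ^ 2 + F₂ p ^ 2) * g (p.1 ^ 2 + p.2 ^ 2)) := by
          refine setLIntegral_mono (by fun_prop) fun p hp => ?_
          rw [show (2 : ℝ≥0∞) = ENNReal.ofReal 2 by simp, ← ENNReal.ofReal_mul (by norm_num)]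
          refine ENNReal.ofReal_le_ofReal ?_
          have h := hg.half_le (p.1 ^ 2 + p.2 ^ 2) (by positivity)
            (by nlinarith [hp.1.1, hp.1.2, hp.2.1, hp.2.2])
          have h2 := mul_le_mul_of_nonneg_left h (show 0 ≤ F₁ p ^ 2 + F₂ p ^ 2 by positivity)
          linarith
      _ ≤ 2 * J := by
          rw [lintegral_const_mul _ (by fun_prop)]
          exact mul_le_mul_right (setLIntegral_le_lintegral _ _) 2
  have hrhs : ∫⁻ p, ENNReal.ofReal ((if p.1 ^ 2 + p.2 ^ 2 ≤ 1 / 4 then 193 else 0) * (F p - m) ^ 2 +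
        8192000 * ((F₁ p ^ 2 + F₂ p ^ 2) * g (p.1 ^ 2 + p.2 ^ 2))) ≤
      193 * (2 * (2 * J)) + 8192000 * J := by
    have hn : ∀ p : ℝ × ℝ, 0 ≤ (F₁ p ^ 2 + F₂ p ^ 2) * g (p.1 ^ 2 + p.2 ^ 2) := fun p =>
      mul_nonneg (by positivity) (hg.nonneg _ (by positivity))
    calc _ = ∫⁻ p, (ENNReal.ofReal ((if p.1 ^ 2 + p.2 ^ 2 ≤ 1 / 4 then 193 else 0) * (F p - m) ^ 2)
          + 8192000 * ENNReal.ofReal ((F₁ p ^ 2 + F₂ p ^ 2) * g (p.1 ^ 2 + p.2 ^ 2))) := by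
          refine lintegral_congr fun p => ?_
          rw [ENNReal.ofReal_add (by split_ifs <;> positivity) (mul_nonneg (by norm_num) (hn p)),
            ENNReal.ofReal_mul (p := (8192000 : ℝ)) (by norm_num), ENNReal.ofReal_ofNat]
      _ = (∫⁻ p, ENNReal.ofReal ((if p.1 ^ 2 + p.2 ^ 2 ≤ 1 / 4 then 193 else 0) * (F p - m) ^ 2))
          + 8192000 * J := by
          rw [lintegral_add_right _ (by fun_prop), lintegral_const_mul _ (by fun_prop)]
      _ ≤ _ := by
          refine add_le_add ?_ le_rfl
          calc _ ≤ ∫⁻ p, (unitInt ×ˢ unitInt).indicator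
                (fun p => 193 * ENNReal.ofReal ((F p - m) ^ 2)) p := by
                refine lintegral_mono fun p => ?_
                split_ifs with h
                · rw [Set.indicator_of_mem, ENNReal.ofReal_mul (by norm_num), ENNReal.ofReal_ofNat]
                  constructor <;> constructor <;>
                    nlinarith [sq_nonneg p.1, sq_nonneg p.2]
                · simp
            _ = 193 * ∫⁻ p in unitInt ×ˢ unitInt, ENNReal.ofReal ((F p - m) ^ 2) := by
                rw [lintegral_indicator (measurableSet_Icc.prod measurableSet_Icc),
                  lintegral_const_mul _ (by fun_prop)]
            _ ≤ _ := mul_le_mul_right (hm.trans (mul_le_mul_right hsq 2)) 193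
  have hbox : ∀ n : ℕ, ∫⁻ p in Set.Icc (-(n : ℝ), -(n : ℝ)) ((n : ℝ), (n : ℝ)),
      ENNReal.ofReal ((F p - m) ^ 2 * g (p.1 ^ 2 + p.2 ^ 2)) ≤ 4096386000 * J := by
    intro n
    refine (hg.lintegral_box_le (F := fun p => F p - m) (fun p => (hF p).sub_const m) hc1 hc2
      (Nat.cast_nonneg n)).trans ((mul_le_mul_right hrhs 500).trans (le_of_eq ?_))
    ring
  have hmono : Monotone fun n : ℕ => Set.Icc (-(n : ℝ), -(n : ℝ)) ((n : ℝ), (n : ℝ)) := by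
    intro a b hab
    have : (a : ℝ) ≤ b := by exact_mod_cast hab
    exact Set.Icc_subset_Icc ⟨by simpa using this, by simpa using this⟩ ⟨this, this⟩
  have hun : ⋃ n : ℕ, Set.Icc (-(n : ℝ), -(n : ℝ)) ((n : ℝ), (n : ℝ)) = Set.univ := by
    refine Set.eq_univ_of_forall fun p => Set.mem_iUnion.2 ?_
    obtain ⟨n, hn⟩ := exists_nat_ge (max |p.1| |p.2|)
    have h1 := abs_le.1 ((le_max_left _ _).trans hn)
    have h2 := abs_le.1 ((le_max_right _ _).trans hn)
    exact ⟨n, ⟨h1.1, h2.1⟩, ⟨h1.2, h2.2⟩⟩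
  rw [← setLIntegral_univ, ← hun, setLIntegral_iUnion_of_directed _ hmono.directed_le]
  exact iSup_le hbox

lemma isRadialProfile_profile (n : ℕ) : IsRadialProfile (profile n) (profileDeriv n) where
  hasDerivAt := hasDerivAt_profile n
  continuous_deriv := continuous_profileDeriv n
  nonneg _ := profile_nonneg n
  le_one _ := profile_le_one n
  half_le _ := half_le_profile n
  deriv_nonpos _ := profileDeriv_nonpos n
  deriv_le _ := profileDeriv_le n

end Divergence


/-! ### Gaussian moments and the total mass of the profile -/

section Gaussian

/-- Half of the Gaussian exponent absorbs the polynomial, through `y^k ≤ k! e^y` at `y = (b/4)(1 +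
r)²` and `(1 + r)² ≤ 2 + 2r²`. -/
lemma integrable_one_add_norm_pow_mul_exp {V : Type*} [NormedAddCommGroup V]
    [InnerProductSpace ℝ V] [FiniteDimensional ℝ V] [MeasurableSpace V] [BorelSpace V]
    (k : ℕ) {b : ℝ} (hb : 0 < b) :
    Integrable fun x : V => (1 + ‖x‖) ^ k * Real.exp (-b * ‖x‖ ^ 2) := by
  have h1 : Integrable fun x : V => Real.exp (-(b / 2) * ‖x‖ ^ 2) := by
    have := (GaussianFourier.integrable_cexp_neg_mul_sq_norm_add (V := V) (b := ((b / 2 : ℝ) : ℂ))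
      (by rw [Complex.ofReal_re]; positivity) 0 0).norm
    refine this.congr (Filter.Eventually.of_forall fun x => ?_)
    simp only [Complex.norm_exp]
    congr 1
    norm_cast
    simp
  refine (h1.const_mul ((k.factorial : ℝ) * (4 / b) ^ k * Real.exp (b / 2))).mono'
    (by fun_prop) (Filter.Eventually.of_forall fun x => ?_)
  rw [Real.norm_of_nonneg (by positivity)]
  set r := ‖x‖
  have hr : 0 ≤ r := norm_nonneg x
  have h2 := Real.pow_div_factorial_le_exp (b / 4 * (1 + r) ^ 2) (by positivity) k
  rw [div_le_iff₀ (by positivity)] at h2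
  have h3 : (1 + r) ^ k ≤ (4 / b) ^ k * (b / 4 * (1 + r) ^ 2) ^ k := by
    rw [← mul_pow]
    gcongr
    have : 4 / b * (b / 4 * (1 + r) ^ 2) = (1 + r) ^ 2 := by field_simp
    rw [this]; nlinarith
  have h4 : Real.exp (b / 4 * (1 + r) ^ 2) ≤ Real.exp (b / 2) * Real.exp (b / 2 * r ^ 2) := by
    rw [← Real.exp_add]
    refine Real.exp_le_exp.2 ?_
    nlinarith [mul_nonneg hb.le (sq_nonneg (1 - r))]
  calc (1 + r) ^ k * Real.exp (-b * r ^ 2)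
      ≤ ((4 / b) ^ k * (Real.exp (b / 2) * Real.exp (b / 2 * r ^ 2) * k.factorial)) *
        Real.exp (-b * r ^ 2) := by
        refine mul_le_mul_of_nonneg_right (h3.trans ?_) (Real.exp_pos _).le
        refine mul_le_mul_of_nonneg_left (h2.trans ?_) (by positivity)
        exact mul_le_mul_of_nonneg_right h4 (by positivity)
    _ = _ := by
        have : Real.exp (-(b / 2) * r ^ 2) =
            Real.exp (b / 2 * r ^ 2) * Real.exp (-b * r ^ 2) := by
          rw [← Real.exp_add]; congr 1; ring
        rw [this]; ring

/-- The Gaussian monomial `z^a \bar z^b e^{-c|z|²}`. -/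
noncomputable def gaussMonomial (c : ℝ) (a b : ℕ) (z : ℂ) : ℂ :=
  z ^ a * (starRingEnd ℂ z) ^ b * (Real.exp (-c * ‖z‖ ^ 2) : ℝ)

lemma integrable_gaussMonomial {c : ℝ} (hc : 0 < c) (a b : ℕ) :
    Integrable (gaussMonomial c a b) := by
  refine (integrable_one_add_norm_pow_mul_exp (V := ℂ) (a + b) hc).mono' ?_
    (Filter.Eventually.of_forall fun z => ?_)
  · unfold gaussMonomial
    exact Continuous.aestronglyMeasurable (by fun_prop)
  · unfold gaussMonomial
    rw [norm_mul, norm_mul, norm_pow, norm_pow, RCLike.norm_conj, Complex.norm_real,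
      Real.norm_of_nonneg (Real.exp_pos _).le, ← pow_add]
    gcongr
    linarith [norm_nonneg z]

lemma gaussMonomial_self (c : ℝ) (a : ℕ) (z : ℂ) :
    gaussMonomial c a a z = ((‖z‖ ^ (2 * a) * Real.exp (-c * ‖z‖ ^ 2) : ℝ) : ℂ) := by
  unfold gaussMonomial
  rw [← mul_pow, Complex.mul_conj']
  push_cast
  ring

lemma integral_norm_pow_mul_exp {c : ℝ} (hc : 0 < c) (l : ℕ) :
    ∫ z : ℂ, ‖z‖ ^ (2 * l) * Real.exp (-c * ‖z‖ ^ 2) =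
      Real.pi * l.factorial / c ^ (l + 1) := by
  have h := Complex.integral_rpow_mul_exp_neg_mul_rpow (p := 2) (q := 2 * l) (b := c) one_le_two
    (by linarith [(Nat.cast_nonneg l : (0 : ℝ) ≤ l)]) hc
  have e1 : (2 * (l : ℝ) + 2) / 2 = (l : ℝ) + 1 := by ring
  have e2 : -(2 * (l : ℝ) + 2) / 2 = -((l + 1 : ℕ) : ℝ) := by push_cast; ring
  rw [e1, e2, Real.Gamma_nat_eq_factorial, Real.rpow_neg hc.le, Real.rpow_natCast] at h
  rw [show Real.pi * l.factorial / c ^ (l + 1) =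
    2 * Real.pi / 2 * (c ^ (l + 1))⁻¹ * l.factorial by ring, ← h]
  refine integral_congr_ae (Filter.Eventually.of_forall fun z => ?_)
  simp only [Real.rpow_two]
  congr 1
  rw [← Real.rpow_natCast]
  push_cast; rfl

lemma integral_gaussMonomial_of_ne (c : ℝ) {a b : ℕ} (hab : a ≠ b) :
    ∫ z, gaussMonomial c a b z = 0 := by
  have hab' : (a : ℝ) - b ≠ 0 := sub_ne_zero.2 (by exact_mod_cast hab)
  -- Rotation by this angle multiplies the monomial by `e^{iπ} = -1` and preserves the volume, so
  -- the integral equals its opposite.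
  set θ : ℝ := Real.pi / (a - b)
  set u : Circle := Circle.exp θ
  have hu : (u : ℂ) ^ a * (starRingEnd ℂ u) ^ b = -1 := by
    rw [Circle.coe_exp, ← Complex.exp_conj, ← Complex.exp_nat_mul, ← Complex.exp_nat_mul,
      ← Complex.exp_add, ← Complex.exp_pi_mul_I]
    congr 1
    have : (Real.pi : ℂ) = ((a : ℂ) - b) * θ := by
      rw [show ((a : ℂ) - b) * θ = (((a : ℝ) - b) * θ : ℝ) by push_cast; rfl,
        mul_div_cancel₀ _ hab']
    simp only [map_mul, Complex.conj_ofReal, Complex.conj_I]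
    rw [this]; ring
  have h1 : ∫ z, gaussMonomial c a b (rotation u z) = ∫ z, gaussMonomial c a b z :=
    (rotation u).measurePreserving.integral_comp
      (rotation u).toHomeomorph.measurableEmbedding _
  have h2 : ∀ z, gaussMonomial c a b (rotation u z) = -gaussMonomial c a b z := fun z => by
    unfold gaussMonomial
    rw [LinearIsometryEquiv.norm_map, rotation_apply, map_mul, mul_pow, mul_pow]
    linear_combination (z ^ a * (starRingEnd ℂ z) ^ b * (Real.exp (-c * ‖z‖ ^ 2) : ℝ)) * hu
  simp_rw [h2, integral_neg] at h1
  exact self_eq_neg.1 h1.symm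

lemma integrable_norm_pow_mul_exp {c : ℝ} (hc : 0 < c) (l : ℕ) :
    Integrable fun z : ℂ => ‖z‖ ^ (2 * l) * Real.exp (-c * ‖z‖ ^ 2) := by
  have h := integrable_gaussMonomial hc l l
  simp_rw [funext (gaussMonomial_self c l)] at h
  exact h.re

lemma profile_norm_sq_eq_sum (n : ℕ) (z : ℂ) : profile n (‖z‖ ^ 2) =
    ∑ l ∈ Finset.range (n + 1), ((n : ℝ) + 1) ^ l / l.factorial *
      (‖z‖ ^ (2 * l) * Real.exp (-((n : ℝ) + 1) * ‖z‖ ^ 2)) := by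
  unfold profile poissonCDF
  rw [Finset.mul_sum]
  refine Finset.sum_congr rfl fun l _ => ?_
  rw [mul_pow, neg_mul]; ring

lemma integrable_profile (n : ℕ) : Integrable fun z : ℂ => profile n (‖z‖ ^ 2) := by
  simp_rw [profile_norm_sq_eq_sum]
  exact integrable_finsetSum _ fun l _ =>
    (integrable_norm_pow_mul_exp (by positivity) l).const_mul _

lemma setIntegral_profile (n : ℕ) (s : Set ℂ) :
    ∫ z in s, profile n (‖z‖ ^ 2) = ∑ l ∈ Finset.range (n + 1), ((n : ℝ) + 1) ^ l / l.factorial *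
      ∫ z in s, ‖z‖ ^ (2 * l) * Real.exp (-((n : ℝ) + 1) * ‖z‖ ^ 2) := by
  simp_rw [profile_norm_sq_eq_sum]
  rw [integral_finsetSum _ fun l _ =>
    ((integrable_norm_pow_mul_exp (by positivity) l).const_mul _).integrableOn]
  simp_rw [integral_const_mul]

lemma integral_profile (n : ℕ) : ∫ z : ℂ, profile n (‖z‖ ^ 2) = Real.pi := by
  rw [← setIntegral_univ, setIntegral_profile]
  simp_rw [setIntegral_univ, integral_norm_pow_mul_exp (show (0 : ℝ) < n + 1 by positivity)]
  have : ∀ l : ℕ, ((n : ℝ) + 1) ^ l / l.factorial *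
      (Real.pi * l.factorial / ((n : ℝ) + 1) ^ (l + 1)) = Real.pi / (n + 1) := fun l => by
    have := Nat.factorial_ne_zero l
    field_simp
    ring
  simp_rw [this]
  simp
  field_simp

end Gaussian

/-! ### Integrating out the Vandermonde determinant -/

section Determinant

open Equiv

/-- Permutations that agree off one point agree there too. Hence distinct permutations already
differ at a particle that is integrated over all of `ℂ`, where orthogonality applies. -/
lemma exists_ne_zero_of_perm_ne {n : ℕ} {σ τ : Perm (Fin (n + 1))} (h : σ ≠ τ) :
    ∃ i, i ≠ 0 ∧ σ i ≠ τ i := by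
  by_contra! H
  apply h
  ext1 i
  by_cases hi : i = 0
  · subst hi
    by_contra h0
    have h1 : τ.symm (σ 0) ≠ 0 := fun h2 => h0 (by rw [← h2, Equiv.apply_symm_apply, h2])
    have h2 := H _ h1
    rw [Equiv.apply_symm_apply] at h2
    exact h1 (σ.injective h2)
  · exact H i hi

/-- The image of `0` under a uniform random permutation is uniform. -/
lemma card_mul_sum_perm {n : ℕ} (f : Fin (n + 1) → ℝ) :
    ((n : ℝ) + 1) * ∑ σ : Perm (Fin (n + 1)), f (σ 0) = (n + 1).factorial * ∑ l, f l := by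
  have h1 : ∀ i : Fin (n + 1), ∑ σ : Perm (Fin (n + 1)), f (σ i) =
      ∑ σ : Perm (Fin (n + 1)), f (σ 0) := fun i => by
    refine Fintype.sum_equiv (Equiv.mulRight (swap 0 i)) _ _ fun σ => ?_
    simp
  have h2 : ∑ i : Fin (n + 1), ∑ σ : Perm (Fin (n + 1)), f (σ i) =
      ((n : ℝ) + 1) * ∑ σ : Perm (Fin (n + 1)), f (σ 0) := by
    simp_rw [h1]; simp
  rw [← h2, Finset.sum_comm]
  simp_rw [fun σ : Perm (Fin (n + 1)) => Equiv.sum_comp σ f]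
  simp [Fintype.card_perm]

/-- The density `e^{-N|z|²} |∏_{i<j} (z_j - z_i)|²` on `ℂ^N`. -/
noncomputable def ginibreDensity (n : ℕ) (z : Fin (n + 1) → ℂ) : ℝ :=
  (∏ i, Real.exp (-((n : ℝ) + 1) * ‖z i‖ ^ 2)) * ‖(Matrix.vandermonde z).det‖ ^ 2

lemma ginibreDensity_nonneg (n : ℕ) (z : Fin (n + 1) → ℂ) : 0 ≤ ginibreDensity n z := by
  unfold ginibreDensity; positivity

lemma ginibreDensity_eq_sum (n : ℕ) (z : Fin (n + 1) → ℂ) :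
    (ginibreDensity n z : ℂ) = ∑ σ : Perm (Fin (n + 1)), ∑ τ : Perm (Fin (n + 1)),
      ((Perm.sign σ : ℤ) : ℂ) * ((Perm.sign τ : ℤ) : ℂ) *
        ∏ i, gaussMonomial ((n : ℝ) + 1) (σ i) (τ i) (z i) := by
  have hdet : (Matrix.vandermonde z).det =
      ∑ σ : Perm (Fin (n + 1)), ((Perm.sign σ : ℤ) : ℂ) * ∏ i, z i ^ (σ i : ℕ) := by
    rw [← Matrix.det_transpose, Matrix.det_apply']
    rfl
  unfold ginibreDensity
  rw [Complex.ofReal_mul, Complex.ofReal_pow, ← Complex.mul_conj', hdet, map_sum,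
    Finset.sum_mul_sum, Finset.mul_sum]
  refine Finset.sum_congr rfl fun σ _ => ?_
  rw [Finset.mul_sum]
  refine Finset.sum_congr rfl fun τ _ => ?_
  unfold gaussMonomial
  rw [Finset.prod_mul_distrib, Finset.prod_mul_distrib, map_mul, map_prod, Complex.ofReal_prod]
  simp only [map_pow, map_intCast]
  ring

/-- By Fubini the integral factors over particles. On the diagonal every factor but that of particle
`0` is a full Gaussian moment, so the product of all moments is corrected by the ratio of the
integral over `s` to the full one. -/
lemma integral_indicator_prod_gaussMonomial (n : ℕ) {s : Set ℂ} (hs : MeasurableSet s)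
    (σ τ : Perm (Fin (n + 1))) :
    Integrable (fun z : Fin (n + 1) → ℂ => ∏ i,
      (if i = 0 then s else Set.univ).indicator
        (gaussMonomial ((n : ℝ) + 1) (σ i) (τ i)) (z i)) ∧
    ∫ z : Fin (n + 1) → ℂ, ∏ i, (if i = 0 then s else Set.univ).indicator
        (gaussMonomial ((n : ℝ) + 1) (σ i) (τ i)) (z i) =
      if σ = τ then (((∏ l : Fin (n + 1), Real.pi * (l : ℕ).factorial / ((n : ℝ) + 1) ^ ((l : ℕ) + 1)) *
        ((((n : ℝ) + 1) ^ ((σ 0 : ℕ) + 1) / (Real.pi * (σ 0 : ℕ).factorial)) *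
        ∫ z in s, ‖z‖ ^ (2 * (σ 0 : ℕ)) * Real.exp (-((n : ℝ) + 1) * ‖z‖ ^ 2)) : ℝ) : ℂ)
      else 0 := by
  have hc : (0 : ℝ) < n + 1 := by positivity
  have hms : ∀ i : Fin (n + 1), MeasurableSet (if i = 0 then s else Set.univ) := fun i => by
    split_ifs
    exacts [hs, MeasurableSet.univ]
  have hint : ∀ i, Integrable ((if i = 0 then s else Set.univ).indicator
        (gaussMonomial ((n : ℝ) + 1) (σ i) (τ i))) := fun i =>
    (integrable_gaussMonomial hc _ _).indicator (hms i)
  refine ⟨Integrable.fintype_prod hint, ?_⟩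
  rw [integral_fintype_prod_volume_eq_prod
    (f := fun i => (if i = 0 then s else Set.univ).indicator
        (gaussMonomial ((n : ℝ) + 1) (σ i) (τ i)))]
  refine (Finset.prod_congr rfl fun i _ => integral_indicator (hms i)).trans ?_
  split_ifs with h
  · subst h
    set m : Fin (n + 1) → ℝ := fun l =>
      Real.pi * (l : ℕ).factorial / ((n : ℝ) + 1) ^ ((l : ℕ) + 1) with hm
    have hm0 : ∀ l, m l ≠ 0 := fun l => by
      have := Nat.factorial_pos (l : ℕ)
      have := Real.pi_pos
      simp only [hm]
      positivity
    rw [← Equiv.prod_comp σ m]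
    rw [Fin.prod_univ_succ, Fin.prod_univ_succ]
    have h1 : ∀ i : Fin n, ∫ z in (if i.succ = 0 then s else Set.univ),
        gaussMonomial ((n : ℝ) + 1) (σ i.succ) (σ i.succ) z = (m (σ i.succ) : ℂ) := fun i => by
      rw [if_neg (Fin.succ_ne_zero i), setIntegral_univ]
      simp_rw [gaussMonomial_self]
      rw [integral_complex_ofReal, integral_norm_pow_mul_exp hc]
    simp_rw [h1, if_true, gaussMonomial_self]
    rw [integral_complex_ofReal, ← Complex.ofReal_prod, ← Complex.ofReal_mul]
    congr 1
    have h2 : ((n : ℝ) + 1) ^ ((σ 0 : ℕ) + 1) / (Real.pi * (σ 0 : ℕ).factorial) = (m (σ 0))⁻¹ := by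
      simp only [hm, inv_div]
    rw [h2]
    have := hm0 (σ 0)
    field_simp
  · obtain ⟨i, hi, hi'⟩ := exists_ne_zero_of_perm_ne h
    refine Finset.prod_eq_zero (Finset.mem_univ i) ?_
    rw [if_neg hi, setIntegral_univ]
    exact integral_gaussMonomial_of_ne _ (fun h => hi' (Fin.ext h))

/-- Up to a constant, the first marginal of the Ginibre density is given by `profile`. -/
theorem exists_setIntegral_ginibreDensity (n : ℕ) : ∃ K : ℝ, 0 < K ∧ ∀ s : Set ℂ, MeasurableSet s →
    IntegrableOn (ginibreDensity n) ((fun z : Fin (n + 1) → ℂ => z 0) ⁻¹' s) ∧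
    ∫ z in (fun z : Fin (n + 1) → ℂ => z 0) ⁻¹' s, ginibreDensity n z =
      K * ∫ z in s, profile n (‖z‖ ^ 2) := by
  have hc : (0 : ℝ) < n + 1 := by positivity
  set M : ℝ := ∏ l : Fin (n + 1), Real.pi * (l : ℕ).factorial / ((n : ℝ) + 1) ^ ((l : ℕ) + 1)
    with hM
  have hMpos : 0 < M := Finset.prod_pos fun l _ => by
    have := Nat.factorial_pos (l : ℕ)
    have := Real.pi_pos
    positivity
  refine ⟨M * ((n + 1).factorial / Real.pi), by have := Real.pi_pos; positivity, fun s hs => ?_⟩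
  have hpre : MeasurableSet ((fun z : Fin (n + 1) → ℂ => z 0) ⁻¹' s) := measurable_pi_apply 0 hs
  have hind : ∀ z : Fin (n + 1) → ℂ,
      ((fun z : Fin (n + 1) → ℂ => z 0) ⁻¹' s).indicator (fun z => (ginibreDensity n z : ℂ)) z =
      ∑ σ : Perm (Fin (n + 1)), ∑ τ : Perm (Fin (n + 1)),
      ((Perm.sign σ : ℤ) : ℂ) * ((Perm.sign τ : ℤ) : ℂ) *
        ∏ i, (if i = 0 then s else Set.univ).indicator
          (gaussMonomial ((n : ℝ) + 1) (σ i) (τ i)) (z i) := fun z => by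
    by_cases hz : z 0 ∈ s
    · rw [Set.indicator_of_mem (by exact hz), ginibreDensity_eq_sum]
      refine Finset.sum_congr rfl fun σ _ => Finset.sum_congr rfl fun τ _ => ?_
      congr 1
      refine Finset.prod_congr rfl fun i _ => ?_
      rw [Set.indicator_of_mem]
      split_ifs with h
      · rw [h]; exact hz
      · trivial
    · rw [Set.indicator_of_notMem (by exact hz)]
      symm
      refine Finset.sum_eq_zero fun σ _ => Finset.sum_eq_zero fun τ _ => ?_
      rw [Finset.prod_eq_zero (Finset.mem_univ 0), mul_zero]
      rw [if_pos rfl, Set.indicator_of_notMem hz]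
  have hI := fun σ τ => integral_indicator_prod_gaussMonomial n hs σ τ
  have hint : Integrable (((fun z : Fin (n + 1) → ℂ => z 0) ⁻¹' s).indicator
      (fun z => (ginibreDensity n z : ℂ))) := by
    rw [funext hind]
    exact integrable_finsetSum _ fun σ _ => integrable_finsetSum _ fun τ _ =>
      ((hI σ τ).1).const_mul _
  rw [integrable_indicator_iff hpre] at hint
  refine ⟨hint.re, ?_⟩
  have hval : ∫ z in (fun z : Fin (n + 1) → ℂ => z 0) ⁻¹' s, (ginibreDensity n z : ℂ) =
      ((M * ∑ σ : Perm (Fin (n + 1)),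
        ((((n : ℝ) + 1) ^ ((σ 0 : ℕ) + 1) / (Real.pi * (σ 0 : ℕ).factorial)) *
        ∫ z in s, ‖z‖ ^ (2 * (σ 0 : ℕ)) * Real.exp (-((n : ℝ) + 1) * ‖z‖ ^ 2)) : ℝ) : ℂ) := by
    rw [← integral_indicator hpre]
    simp_rw [hind]
    rw [integral_finsetSum _ fun σ _ => integrable_finsetSum _ fun τ _ =>
      ((hI σ τ).1).const_mul _, Finset.mul_sum, Complex.ofReal_sum]
    refine Finset.sum_congr rfl fun σ _ => ?_
    rw [integral_finsetSum _ fun τ _ => ((hI σ τ).1).const_mul _]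
    simp_rw [integral_const_mul, (hI σ _).2]
    rw [Finset.sum_eq_single σ]
    · rw [if_pos rfl]
      have : ((Perm.sign σ : ℤ) : ℂ) * ((Perm.sign σ : ℤ) : ℂ) = 1 := by
        rw [← Int.cast_mul, ← Units.val_mul, Int.units_mul_self]; simp
      rw [this, one_mul]
    · intro τ _ h
      rw [if_neg h.symm, mul_zero]
    · simp
  rw [integral_complex_ofReal] at hval
  rw [Complex.ofReal_injective hval, mul_assoc]
  congr 1
  have h5 := card_mul_sum_perm (n := n) fun l =>
    ((((n : ℝ) + 1) ^ ((l : ℕ) + 1) / (Real.pi * (l : ℕ).factorial)) *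
        ∫ z in s, ‖z‖ ^ (2 * (l : ℕ)) * Real.exp (-((n : ℝ) + 1) * ‖z‖ ^ 2))
  rw [setIntegral_profile, ← mul_right_inj' hc.ne', h5, Finset.sum_range, mul_left_comm ((n : ℝ) + 1),
    div_mul_eq_mul_div, mul_div_assoc]
  congr 1
  rw [Finset.mul_sum, Finset.sum_div]
  refine Finset.sum_congr rfl fun l _ => ?_
  have := Nat.factorial_ne_zero (l : ℕ)
  have := Real.pi_ne_zero
  field_simp
  ring

end Determinant


/-! ### From the Gibbs measure to the marginal density -/

section Transport

/-- The isometry between `Plane` and `ℂ`. -/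
noncomputable def planeToComplex : Plane ≃ₗᵢ[ℝ] ℂ := Complex.orthonormalBasisOneI.repr.symm

/-- The linear equivalence between `ℂ^N` and the space of configurations. -/
noncomputable def configEquiv (N : ℕ) : (Fin N → ℂ) ≃L[ℝ] Config N :=
  (ContinuousLinearEquiv.piCongrRight
    fun _ => planeToComplex.symm.toContinuousLinearEquiv).trans
      (PiLp.continuousLinearEquiv 2 ℝ fun _ : Fin N => Plane).symm

lemma configEquiv_apply {N : ℕ} (z : Fin N → ℂ) (i : Fin N) :
    configEquiv N z i = planeToComplex.symm (z i) := rfl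

lemma planeToComplex_configEquiv {N : ℕ} (z : Fin N → ℂ) :
    (fun i => planeToComplex (configEquiv N z i)) = z := by
  ext1 i
  rw [configEquiv_apply, LinearIsometryEquiv.apply_symm_apply]

/-- The Ginibre density on the space of configurations. -/
noncomputable def configDensity (n : ℕ) (x : Config (n + 1)) : ℝ :=
  ginibreDensity n fun i => planeToComplex (x i)

/-- The Vandermonde determinant of a configuration. -/
noncomputable def configVandermonde {n : ℕ} (x : Config (n + 1)) : ℂ :=
  (Matrix.vandermonde fun i => planeToComplex (x i)).det

lemma configDensity_eq (n : ℕ) (x : Config (n + 1)) :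
    configDensity n x = Real.exp (-((n : ℝ) + 1) * ‖x‖ ^ 2) * ‖configVandermonde x‖ ^ 2 := by
  unfold configDensity ginibreDensity configVandermonde
  rw [← Real.exp_sum, ← Finset.mul_sum, PiLp.norm_sq_eq_of_L2]
  simp only [LinearIsometryEquiv.norm_map]

lemma configVandermonde_ne_zero_iff {n : ℕ} (x : Config (n + 1)) :
    configVandermonde x ≠ 0 ↔ x ∈ distinctConfigs (n + 1) := by
  unfold configVandermonde distinctConfigs
  rw [Matrix.det_vandermonde_ne_zero_iff]
  constructor
  · intro h i j hij hx
    exact hij (h (by simp [hx]))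
  · intro h i j hij
    by_contra hne
    exact h i j hne (planeToComplex.injective hij)

lemma continuous_configVandermonde (n : ℕ) :
    Continuous (configVandermonde : Config (n + 1) → ℂ) := by
  unfold configVandermonde
  simp_rw [Matrix.det_vandermonde]
  fun_prop

lemma continuous_configDensity (n : ℕ) : Continuous (configDensity n) := by
  have := continuous_configVandermonde n
  simp_rw [funext (configDensity_eq n)]
  fun_prop

lemma configDensity_nonneg (n : ℕ) (x : Config (n + 1)) : 0 ≤ configDensity n x :=
  ginibreDensity_nonneg _ _

lemma isOpen_distinctConfigs (n : ℕ) : IsOpen (distinctConfigs (n + 1)) := by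
  have : distinctConfigs (n + 1) = {x | configVandermonde x ≠ 0} := by
    ext x; exact (configVandermonde_ne_zero_iff x).symm
  rw [this]
  exact isOpen_ne_fun (continuous_configVandermonde n) continuous_const

lemma sum_ite_ne_eq {N : ℕ} (a : Fin N → Fin N → ℝ) (ha : ∀ i j, a i j = a j i) :
    ∑ i, ∑ j, (if i ≠ j then a i j else 0) = 2 * ∑ i, ∑ j ∈ Finset.Ioi i, a i j := by
  have h1 : ∀ i j : Fin N, (if i ≠ j then a i j else 0) =
      (if i < j then a i j else 0) + (if j < i then a j i else 0) := fun i j => by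
    rcases lt_trichotomy i j with h | h | h
    · simp [h, h.ne, h.not_gt]
    · simp [h]
    · simp [h, h.ne', h.not_gt, ha i j]
  simp_rw [h1, Finset.sum_add_distrib]
  rw [Finset.sum_comm (f := fun i j : Fin N => if j < i then a j i else 0), ← two_mul]
  congr 1
  refine Finset.sum_congr rfl fun i _ => ?_
  rw [← Finset.sum_filter]
  congr 1
  ext j; simp

/-- With `β = N²` the coefficients of the energy become `N` and `1/2`; the `1/2` cancels the double
count of each pair, so every pair contributes `|x_i - x_j|²`. -/
lemma exp_neg_energy (n : ℕ) {x : Config (n + 1)} (hx : x ∈ distinctConfigs (n + 1)) :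
    Real.exp (-(((n + 1 : ℕ) : ℝ) ^ 2) * energy (n + 1) x) = configDensity n x := by
  have hpos : ∀ i j : Fin (n + 1), i ≠ j → 0 < ‖x i - x j‖ ^ 2 := fun i j hij => by
    have := norm_pos_iff.2 (sub_ne_zero.2 (hx i j hij))
    positivity
  rw [configDensity_eq]
  have hV : ‖configVandermonde x‖ ^ 2 =
      Real.exp (∑ i, ∑ j ∈ Finset.Ioi i, Real.log (‖x i - x j‖ ^ 2)) := by
    unfold configVandermonde
    rw [Matrix.det_vandermonde, norm_prod, ← Finset.prod_pow, Real.exp_sum]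
    refine Finset.prod_congr rfl fun i _ => ?_
    rw [norm_prod, ← Finset.prod_pow, Real.exp_sum]
    refine Finset.prod_congr rfl fun j hj => ?_
    rw [Real.exp_log (hpos i j (Finset.mem_Ioi.1 hj).ne), ← map_sub,
      LinearIsometryEquiv.norm_map, norm_sub_rev]
  rw [hV, ← Real.exp_add]
  congr 1
  have hN : ((n + 1 : ℕ) : ℝ) ≠ 0 := by positivity
  unfold energy
  rw [sum_ite_ne_eq (fun i j => interaction (x i - x j)) fun i j => by
    unfold interaction; rw [norm_sub_rev]]
  have h2 : ∀ i j : Fin (n + 1), interaction (x i - x j) = -Real.log (‖x i - x j‖ ^ 2) :=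
    fun i j => by unfold interaction; rw [one_div, Real.log_inv]
  simp_rw [h2, Finset.sum_neg_distrib, confinement]
  rw [PiLp.norm_sq_eq_of_L2]
  push_cast at hN ⊢
  field_simp
  ring

/-- The Vandermonde determinant vanishes at collisions, so the restriction to distinct
configurations is automatic. -/
lemma gibbsWeight_eq (n : ℕ) : gibbsWeight (n + 1) (((n + 1 : ℕ) : ℝ) ^ 2) =
    volume.withDensity fun x => ENNReal.ofReal (configDensity n x) := by
  unfold gibbsWeight
  rw [← withDensity_indicator (isOpen_distinctConfigs n).measurableSet]
  congr 1
  ext1 x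
  by_cases hx : x ∈ distinctConfigs (n + 1)
  · rw [Set.indicator_of_mem hx, exp_neg_energy n hx]
  · rw [Set.indicator_of_notMem hx, configDensity_eq]
    have : configVandermonde x = 0 := by
      by_contra h
      exact hx ((configVandermonde_ne_zero_iff x).1 h)
    rw [this]; simp

/-- The unnormalized one-particle density `z ↦ profile n |z|²`, as a measure on the plane. -/
noncomputable def profileMeasure (n : ℕ) : Measure Plane :=
  volume.withDensity fun z => ENNReal.ofReal (profile n (‖z‖ ^ 2))

lemma profileMeasure_univ (n : ℕ) : profileMeasure n Set.univ = ENNReal.ofReal Real.pi := by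
  unfold profileMeasure
  rw [withDensity_apply _ MeasurableSet.univ, setLIntegral_univ, ← integral_profile n,
    ofReal_integral_eq_lintegral_ofReal (integrable_profile n)
      (Filter.Eventually.of_forall fun z => profile_nonneg n (sq_nonneg _)),
    ← planeToComplex.measurePreserving.lintegral_comp_emb
      planeToComplex.toHomeomorph.measurableEmbedding]
  simp only [LinearIsometryEquiv.norm_map]

theorem exists_map_gibbsWeight (n : ℕ) : ∃ K : ℝ≥0∞, K ≠ 0 ∧ K ≠ ∞ ∧
    (gibbsWeight (n + 1) (((n + 1 : ℕ) : ℝ) ^ 2)).map (fun x => x 0) = K • profileMeasure n := by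
  obtain ⟨K, hK, hKs⟩ := exists_setIntegral_ginibreDensity n
  set e := configEquiv (n + 1)
  -- By uniqueness of Haar measure the linear change of variables only costs a positive finite
  -- factor, which the normalization removes later.
  have hhaar : Measure.IsAddHaarMeasure
      ((volume : Measure (Fin (n + 1) → ℂ)).map e) :=
    ContinuousLinearEquiv.isAddHaarMeasure_map e volume
  set c := Measure.addHaarScalarFactor (volume : Measure (Config (n + 1)))
    ((volume : Measure (Fin (n + 1) → ℂ)).map e) with hc
  have hvol : (volume : Measure (Config (n + 1))) =
      c • (volume : Measure (Fin (n + 1) → ℂ)).map e :=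
    Measure.isAddLeftInvariant_eq_smul _ _
  have hc0 : c ≠ 0 := (Measure.addHaarScalarFactor_pos_of_isAddHaarMeasure _ _).ne'
  refine ⟨c * ENNReal.ofReal K, ?_, ?_, ?_⟩
  · exact mul_ne_zero (by simpa using hc0) (by simpa using hK)
  · exact ENNReal.mul_ne_top ENNReal.coe_ne_top ENNReal.ofReal_ne_top
  ext s hs
  have hm0 : Measurable fun x : Config (n + 1) => x 0 := by fun_prop
  have hs' : MeasurableSet (planeToComplex.symm ⁻¹' s) :=
    planeToComplex.symm.continuous.measurable hs
  have hcd : Measurable fun x => ENNReal.ofReal (configDensity n x) :=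
    (continuous_configDensity n).measurable.ennreal_ofReal
  have hpre : (fun z => e z) ⁻¹' ((fun x : Config (n + 1) => x 0) ⁻¹' s) =
      (fun z : Fin (n + 1) → ℂ => z 0) ⁻¹' (planeToComplex.symm ⁻¹' s) := rfl
  rw [Measure.map_apply hm0 hs, gibbsWeight_eq, withDensity_apply _ (hm0 hs), hvol,
    Measure.restrict_smul, lintegral_smul_measure,
    setLIntegral_map (hm0 hs) hcd e.continuous.measurable, hpre]
  have h1 : ∀ z, configDensity n (e z) = ginibreDensity n z := fun z => by
    unfold configDensity
    rw [planeToComplex_configEquiv]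
  simp_rw [h1]
  rw [← ofReal_integral_eq_lintegral_ofReal (hKs _ hs').1
    (Filter.Eventually.of_forall fun z => ginibreDensity_nonneg n z), (hKs _ hs').2,
    ENNReal.ofReal_mul hK.le, ofReal_integral_eq_lintegral_ofReal
      (integrable_profile n).integrableOn
      (Filter.Eventually.of_forall fun z => profile_nonneg n (sq_nonneg _))]
  have h2 : ∫⁻ z in planeToComplex.symm ⁻¹' s, ENNReal.ofReal (profile n (‖z‖ ^ 2)) =
      profileMeasure n s := by
    unfold profileMeasure
    rw [withDensity_apply _ hs, ← planeToComplex.symm.measurePreserving.setLIntegral_comp_preimage_emb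
      planeToComplex.symm.toHomeomorph.measurableEmbedding]
    simp only [LinearIsometryEquiv.norm_map]
  rw [h2, Measure.smul_apply, smul_eq_mul, ENNReal.smul_def, smul_eq_mul, mul_assoc]

lemma partitionFunction_eq (N : ℕ) (β : ℝ) :
    partitionFunction N β = gibbsWeight N β Set.univ := by
  unfold partitionFunction gibbsWeight
  rw [withDensity_apply _ MeasurableSet.univ, setLIntegral_univ]

lemma exists_partitionFunction_eq (n : ℕ) : ∃ K : ℝ≥0∞, K ≠ 0 ∧ K ≠ ∞ ∧
    partitionFunction (n + 1) (((n + 1 : ℕ) : ℝ) ^ 2) = K * ENNReal.ofReal Real.pi ∧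
    (gibbsWeight (n + 1) (((n + 1 : ℕ) : ℝ) ^ 2)).map (fun x => x 0) = K • profileMeasure n := by
  obtain ⟨K, h0, h1, h2⟩ := exists_map_gibbsWeight n
  refine ⟨K, h0, h1, ?_, h2⟩
  have hm0 : Measurable fun x : Config (n + 1) => x 0 := by fun_prop
  rw [partitionFunction_eq, ← Set.preimage_univ (f := fun x : Config (n + 1) => x 0),
    ← Measure.map_apply hm0 MeasurableSet.univ, h2, Measure.smul_apply, profileMeasure_univ,
    smul_eq_mul]

lemma partitionFunction_ne_zero (n : ℕ) :
    partitionFunction (n + 1) (((n + 1 : ℕ) : ℝ) ^ 2) ≠ 0 := by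
  obtain ⟨K, h0, h1, h2, -⟩ := exists_partitionFunction_eq n
  rw [h2]
  exact mul_ne_zero h0 (by simpa using Real.pi_pos)

lemma partitionFunction_ne_top (n : ℕ) :
    partitionFunction (n + 1) (((n + 1 : ℕ) : ℝ) ^ 2) ≠ ∞ := by
  obtain ⟨K, h0, h1, h2, -⟩ := exists_partitionFunction_eq n
  rw [h2]
  exact ENNReal.mul_ne_top h1 ENNReal.ofReal_ne_top

instance isProbabilityMeasure_gibbsMeasure (n : ℕ) :
    IsProbabilityMeasure (gibbsMeasure (n + 1) (((n + 1 : ℕ) : ℝ) ^ 2)) := by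
  refine ⟨?_⟩
  unfold gibbsMeasure
  rw [Measure.smul_apply, smul_eq_mul, ← partitionFunction_eq]
  exact ENNReal.inv_mul_cancel (partitionFunction_ne_zero n) (partitionFunction_ne_top n)

/-- The one-particle marginal has density `z ↦ π⁻¹ profile n |z|²`. -/
theorem oneParticleMarginal_eq (n : ℕ) : oneParticleMarginal (n + 1) (((n + 1 : ℕ) : ℝ) ^ 2) =
    (ENNReal.ofReal Real.pi)⁻¹ • profileMeasure n := by
  obtain ⟨K, h0, h1, h2, h3⟩ := exists_partitionFunction_eq n
  unfold oneParticleMarginal gibbsMeasure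
  rw [Measure.map_smul, h3, h2, smul_smul, ENNReal.mul_inv (Or.inl h0) (Or.inl h1), mul_right_comm,
    ENNReal.inv_mul_cancel h0 h1, one_mul]

instance isProbabilityMeasure_oneParticleMarginal (n : ℕ) :
    IsProbabilityMeasure (oneParticleMarginal (n + 1) (((n + 1 : ℕ) : ℝ) ^ 2)) :=
  Measure.isProbabilityMeasure_map (by fun_prop)

end Transport

/-! ### Poincaré inequality for the one-particle marginal -/

section Marginal

/-- Cartesian coordinates on `Plane`. -/
noncomputable def prodToPlane : (ℝ × ℝ) ≃L[ℝ] Plane :=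
  Complex.equivRealProdCLM.symm.trans planeToComplex.symm.toContinuousLinearEquiv

lemma prodToPlane_apply (p : ℝ × ℝ) :
    prodToPlane p = planeToComplex.symm (Complex.equivRealProdCLM.symm p) := rfl

lemma measurePreserving_prodToPlane : MeasurePreserving prodToPlane :=
  planeToComplex.symm.measurePreserving.comp
    (Complex.volume_preserving_equiv_real_prod.symm Complex.measurableEquivRealProd)

lemma inner_prodToPlane (p q : ℝ × ℝ) :
    inner ℝ (prodToPlane p) (prodToPlane q) = p.1 * q.1 + p.2 * q.2 := by
  rw [prodToPlane_apply, prodToPlane_apply, LinearIsometryEquiv.inner_map_map, Complex.inner]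
  simp
  ring

lemma norm_prodToPlane_sq (p : ℝ × ℝ) : ‖prodToPlane p‖ ^ 2 = p.1 ^ 2 + p.2 ^ 2 := by
  rw [← real_inner_self_eq_norm_sq, inner_prodToPlane]; ring

lemma evariance_le_lintegral_sub_sq {Ω : Type*} [MeasurableSpace Ω] {μ : Measure Ω}
    [IsProbabilityMeasure μ] {f : Ω → ℝ} (hf : AEStronglyMeasurable f μ) (m : ℝ) :
    ProbabilityTheory.evariance f μ ≤ ∫⁻ x, ENNReal.ofReal ((f x - m) ^ 2) ∂μ := by
  by_cases h : MemLp f 2 μ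
  · have h1 : MemLp (fun x => f x - m) 2 μ := h.sub (memLp_const m)
    rw [← h.ofReal_variance_eq, ← ProbabilityTheory.variance_sub_const hf m,
      ← ofReal_integral_eq_lintegral_ofReal h1.integrable_sq
        (Filter.Eventually.of_forall fun x => sq_nonneg _)]
    exact ENNReal.ofReal_le_ofReal (ProbabilityTheory.variance_le_expectation_sq h1.1)
  -- If `f` is not square integrable, neither is `f - m`, and the right side is infinite.
  · have h1 : ¬ MemLp (fun x => f x - m) 2 μ := fun h1 =>
      h (by simpa [Pi.add_def] using h1.add (memLp_const m))
    refine le_of_le_of_eq le_top (Eq.symm ?_)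
    by_contra h2
    refine h1 ((memLp_two_iff_integrable_sq (hf.sub aestronglyMeasurable_const)).2 ?_)
    refine ⟨(hf.sub aestronglyMeasurable_const).pow 2, ?_⟩
    rw [hasFiniteIntegral_iff_ofReal (Filter.Eventually.of_forall fun x => sq_nonneg _)]
    exact lt_top_iff_ne_top.2 h2

theorem exists_lintegral_profileMeasure_le (n : ℕ) {f : Plane → ℝ} (hf : ContDiff ℝ 1 f) :
    ∃ m : ℝ, ∫⁻ z, ENNReal.ofReal ((f z - m) ^ 2) ∂(profileMeasure n) ≤
      4096386000 * ∫⁻ z, ‖gradient f z‖ₑ ^ 2 ∂(profileMeasure n) := by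
  have hfd : Differentiable ℝ f := hf.differentiable one_ne_zero
  have hfc : Continuous (fderiv ℝ f) := hf.continuous_fderiv one_ne_zero
  have hgc : Continuous (gradient f) := (InnerProductSpace.toDual ℝ Plane).symm.continuous.comp hfc
  have hpc := continuous_profile n
  set T := prodToPlane with hT
  obtain ⟨m, hm⟩ := (isRadialProfile_profile n).exists_lintegral_le (F := fun p => f (T p))
    (F₁ := fun p => fderiv ℝ f (T p) (T (1, 0))) (F₂ := fun p => fderiv ℝ f (T p) (T (0, 1)))
    (fun p => by
      convert! (hfd (T p)).hasFDerivAt.comp p (T : (ℝ × ℝ) →L[ℝ] Plane).hasFDerivAt using 1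
      ext <;> simp)
    (by fun_prop) (by fun_prop)
  refine ⟨m, ?_⟩
  have hgrad : ∀ p, fderiv ℝ f (T p) (T (1, 0)) ^ 2 + fderiv ℝ f (T p) (T (0, 1)) ^ 2 =
      ‖gradient f (T p)‖ ^ 2 := fun p => by
    have h1 : ∀ v, fderiv ℝ f (T p) v = inner ℝ (gradient f (T p)) v := fun v => by
      rw [← toDual_gradient]; rfl
    rw [h1, h1, ← T.apply_symm_apply (gradient f (T p)), hT, inner_prodToPlane, inner_prodToPlane,
      norm_prodToPlane_sq]
    simp
  simp_rw [hgrad, ← norm_prodToPlane_sq] at hm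
  have hemb : MeasurableEmbedding T := T.toHomeomorph.measurableEmbedding
  have e1 := measurePreserving_prodToPlane.lintegral_comp_emb hemb
    fun z => ENNReal.ofReal ((f z - m) ^ 2 * profile n (‖z‖ ^ 2))
  have e2 := measurePreserving_prodToPlane.lintegral_comp_emb hemb
    fun z => ENNReal.ofReal (‖gradient f z‖ ^ 2 * profile n (‖z‖ ^ 2))
  rw [e1, e2] at hm
  unfold profileMeasure
  have hfc' := hf.continuous
  rw [lintegral_withDensity_eq_lintegral_mul _ (by fun_prop) (by fun_prop),
    lintegral_withDensity_eq_lintegral_mul _ (by fun_prop) (by fun_prop)]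
  simp_rw [ENNReal.ofReal_mul (sq_nonneg _), ENNReal.ofReal_pow (norm_nonneg _),
    ofReal_norm] at hm
  simp_rw [Pi.mul_apply, mul_comm (ENNReal.ofReal (profile n _))]
  exact hm

/-- The Poincaré inequality for the one-particle marginal, with a constant independent of `N`. -/
theorem poincareInequality_oneParticleMarginal (n : ℕ) :
    PoincareInequality (oneParticleMarginal (n + 1) (((n + 1 : ℕ) : ℝ) ^ 2))
      (smoothFunctions Plane) 4096386000 := by
  refine ⟨by norm_num, fun f hf => ?_⟩
  have hf1 : ContDiff ℝ 1 f := ContDiff.of_le (show ContDiff ℝ (⊤ : ℕ∞) f from hf) (by exact_mod_cast le_top)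
  obtain ⟨m, hm⟩ := exists_lintegral_profileMeasure_le n hf1
  refine (evariance_le_lintegral_sub_sq hf1.continuous.aestronglyMeasurable m).trans ?_
  rw [oneParticleMarginal_eq, lintegral_smul_measure, lintegral_smul_measure, smul_eq_mul,
    smul_eq_mul, mul_left_comm]
  exact mul_le_mul_right hm _

end Marginal


/-! ### Cutoffs away from collisions and infinity -/

section Cutoff

open Filter Topology

lemma deriv_smoothTransition_of_notMem {t : ℝ} (ht : t ∉ Set.Icc (0 : ℝ) 1) :
    deriv Real.smoothTransition t = 0 := by
  rw [Set.mem_Icc, not_and_or, not_le, not_le] at ht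
  rcases ht with h | h
  · have : Real.smoothTransition =ᶠ[𝓝 t] fun _ => 0 := by
      filter_upwards [Iio_mem_nhds h] with u hu
      exact Real.smoothTransition.zero_of_nonpos (le_of_lt hu)
    rw [this.deriv_eq, deriv_const]
  · have : Real.smoothTransition =ᶠ[𝓝 t] fun _ => 1 := by
      filter_upwards [Ioi_mem_nhds h] with u hu
      exact Real.smoothTransition.one_of_one_le (le_of_lt hu)
    rw [this.deriv_eq, deriv_const]

lemma exists_abs_deriv_smoothTransition_le :
    ∃ L : ℝ, 0 ≤ L ∧ ∀ t, |deriv Real.smoothTransition t| ≤ L := by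
  have hc : Continuous (deriv Real.smoothTransition) :=
    (Real.smoothTransition.contDiff (n := 1)).continuous_deriv le_rfl
  obtain ⟨L, hL⟩ := (isCompact_Icc (a := (0 : ℝ)) (b := 1)).exists_bound_of_continuousOn
    hc.continuousOn
  refine ⟨max L 0, le_max_right _ _, fun t => ?_⟩
  by_cases ht : t ∈ Set.Icc (0 : ℝ) 1
  · exact (hL t ht).trans (le_max_left _ _)
  · rw [deriv_smoothTransition_of_notMem ht, abs_zero]
    exact le_max_right _ _

lemma hasTemperateGrowth_prod {E ι : Type*} [NormedAddCommGroup E] [NormedSpace ℝ E]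
    {f : ι → E → ℂ} (s : Finset ι) (hf : ∀ i ∈ s, (f i).HasTemperateGrowth) :
    (fun x => ∏ i ∈ s, f i x).HasTemperateGrowth := by
  classical
  induction s using Finset.induction_on with
  | empty =>
    simp_rw [Finset.prod_empty]
    exact Function.HasTemperateGrowth.const 1
  | insert a s ha ih =>
    simp_rw [Finset.prod_insert ha]
    exact (hf a (Finset.mem_insert_self _ _)).mul
      (ih fun i hi => hf i (Finset.mem_insert_of_mem hi))

/-- A product of linear forms; this provides the polynomial bounds on the determinant and its
derivative used for domination. -/
lemma hasTemperateGrowth_configVandermonde (n : ℕ) :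
    (configVandermonde : Config (n + 1) → ℂ).HasTemperateGrowth := by
  unfold configVandermonde
  simp_rw [Matrix.det_vandermonde]
  refine hasTemperateGrowth_prod _ fun i _ => hasTemperateGrowth_prod _ fun j _ => ?_
  let T : Fin (n + 1) → Config (n + 1) →L[ℝ] ℂ := fun i =>
    (planeToComplex.toContinuousLinearEquiv : Plane →L[ℝ] ℂ).comp
      (PiLp.proj 2 (fun _ : Fin (n + 1) => Plane) i)
  exact (T j - T i).hasTemperateGrowth

lemma exists_configVandermonde_growth (n : ℕ) : ∃ (k : ℕ) (C : ℝ), 0 ≤ C ∧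
    (∀ x : Config (n + 1), ‖configVandermonde x‖ ≤ C * (1 + ‖x‖) ^ k) ∧
    ∀ x : Config (n + 1), ‖fderiv ℝ configVandermonde x‖ ≤ C * (1 + ‖x‖) ^ k := by
  obtain ⟨k, C, hC, h⟩ :=
    (hasTemperateGrowth_configVandermonde n).norm_iteratedFDeriv_le_uniform 1
  refine ⟨k, C, hC, fun x => ?_, fun x => ?_⟩
  · simpa using h 0 (by norm_num) x
  · simpa [norm_iteratedFDeriv_one] using h 1 le_rfl x

/-- The first coordinate of the first particle. -/
noncomputable def firstCoord (n : ℕ) : Config (n + 1) →L[ℝ] ℝ :=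
  (EuclideanSpace.proj (0 : Fin 2) : Plane →L[ℝ] ℝ).comp
    (PiLp.proj 2 (fun _ : Fin (n + 1) => Plane) 0)

lemma abs_firstCoord_le {n : ℕ} (x : Config (n + 1)) : |firstCoord n x| ≤ ‖x‖ :=
  (PiLp.norm_apply_le (x 0) 0).trans (PiLp.norm_apply_le x 0)

lemma norm_firstCoord_le (n : ℕ) : ‖firstCoord n‖ ≤ 1 :=
  ContinuousLinearMap.opNorm_le_bound _ zero_le_one fun x => by
    rw [one_mul]; exact abs_firstCoord_le x

/-- The first coordinate of the first particle, cut off near collisions and at infinity. -/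
noncomputable def cutCoord (n m : ℕ) (x : Config (n + 1)) : ℝ :=
  firstCoord n x * (Real.smoothTransition (((m : ℝ) + 1) * ‖configVandermonde x‖ ^ 2 - 1) *
    Real.smoothTransition (2 - ‖x‖ ^ 2 / ((m : ℝ) + 1)))

lemma abs_cutCoord_le {n : ℕ} (m : ℕ) (x : Config (n + 1)) : |cutCoord n m x| ≤ ‖x‖ := by
  unfold cutCoord
  rw [abs_mul, abs_mul, abs_of_nonneg (Real.smoothTransition.nonneg _),
    abs_of_nonneg (Real.smoothTransition.nonneg _)]
  refine (mul_le_of_le_one_right (abs_nonneg _) ?_).trans (abs_firstCoord_le x)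
  exact mul_le_one₀ (Real.smoothTransition.le_one _) (Real.smoothTransition.nonneg _)
    (Real.smoothTransition.le_one _)

lemma contDiff_configVandermonde (n : ℕ) :
    ContDiff ℝ (⊤ : ℕ∞) (configVandermonde : Config (n + 1) → ℂ) :=
  (hasTemperateGrowth_configVandermonde n).1

lemma contDiff_cutCoord (n m : ℕ) : ContDiff ℝ (⊤ : ℕ∞) (cutCoord n m) := by
  have h1 := (contDiff_configVandermonde n).norm_sq ℝ
  have h2 : ContDiff ℝ (⊤ : ℕ∞) (fun x : Config (n + 1) => ‖x‖ ^ 2) := contDiff_norm_sq ℝ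
  unfold cutCoord
  refine (firstCoord n).contDiff.mul (ContDiff.mul ?_ ?_)
  · exact Real.smoothTransition.contDiff.comp ((contDiff_const.mul h1).sub contDiff_const)
  · exact Real.smoothTransition.contDiff.comp (contDiff_const.sub (h2.div_const _))

lemma cutCoord_mem (n m : ℕ) :
    cutCoord n m ∈ smoothCompactlySupportedIn (distinctConfigs (n + 1)) := by
  have hV := continuous_configVandermonde n
  have hm : (0 : ℝ) < (m : ℝ) + 1 := by positivity
  set S : Set (Config (n + 1)) := {x | 1 ≤ ((m : ℝ) + 1) * ‖configVandermonde x‖ ^ 2 ∧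
    ‖x‖ ^ 2 / ((m : ℝ) + 1) ≤ 2} with hS
  have hSc : IsClosed S :=
    IsClosed.inter (s₁ := {x | 1 ≤ ((m : ℝ) + 1) * ‖configVandermonde x‖ ^ 2})
      (s₂ := {x | ‖x‖ ^ 2 / ((m : ℝ) + 1) ≤ 2})
      (isClosed_le continuous_const (by fun_prop)) (isClosed_le (by fun_prop) continuous_const)
  have hsupp : Function.support (cutCoord n m) ⊆ S := by
    intro x hx
    rw [Function.mem_support, cutCoord] at hx
    have h1 := right_ne_zero_of_mul hx
    constructor
    · by_contra h
      exact left_ne_zero_of_mul h1 (Real.smoothTransition.zero_of_nonpos (by linarith))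
    · by_contra h
      exact right_ne_zero_of_mul h1 (Real.smoothTransition.zero_of_nonpos (by linarith))
  have hScomp : IsCompact S := by
    refine (isCompact_closedBall (0 : Config (n + 1)) (2 * ((m : ℝ) + 1))).of_isClosed_subset hSc
      fun x hx => ?_
    rw [mem_closedBall_zero_iff]
    have h := hx.2
    rw [div_le_iff₀ hm] at h
    have hm1 : (1 : ℝ) ≤ (m : ℝ) + 1 := by linarith [(Nat.cast_nonneg m : (0 : ℝ) ≤ m)]
    nlinarith [norm_nonneg x]
  refine ⟨contDiff_cutCoord n m, HasCompactSupport.of_support_subset_isCompact hScomp hsupp,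
    (closure_minimal hsupp hSc).trans fun x hx => ?_⟩
  rw [← configVandermonde_ne_zero_iff]
  intro h0
  have := hx.1
  rw [h0] at this
  norm_num at this

lemma eventually_cutCoord_eventuallyEq {n : ℕ} {x : Config (n + 1)}
    (hx : configVandermonde x ≠ 0) :
    ∀ᶠ m : ℕ in atTop, cutCoord n m =ᶠ[𝓝 x] firstCoord n := by
  have hV := continuous_configVandermonde n
  have hA : 0 < ‖configVandermonde x‖ ^ 2 := by have := norm_pos_iff.2 hx; positivity
  have ht : Tendsto (fun m : ℕ => (m : ℝ) + 1) atTop atTop :=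
    tendsto_atTop_add_const_right _ _ tendsto_natCast_atTop_atTop
  filter_upwards [ht.eventually_gt_atTop (2 / ‖configVandermonde x‖ ^ 2),
    ht.eventually_gt_atTop (‖x‖ ^ 2)] with m h1 h2
  have hm : (0 : ℝ) < (m : ℝ) + 1 := by positivity
  rw [div_lt_iff₀ hA] at h1
  have c1 : ∀ᶠ y in 𝓝 x, 2 < ((m : ℝ) + 1) * ‖configVandermonde y‖ ^ 2 :=
    (show Continuous fun y : Config (n + 1) => ((m : ℝ) + 1) * ‖configVandermonde y‖ ^ 2 by
      fun_prop).continuousAt.eventually (lt_mem_nhds h1)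
  have c2 : ∀ᶠ y in 𝓝 x, ‖y‖ ^ 2 < (m : ℝ) + 1 :=
    (show Continuous fun y : Config (n + 1) => ‖y‖ ^ 2 by
      fun_prop).continuousAt.eventually (gt_mem_nhds h2)
  filter_upwards [c1, c2] with y h3 h4
  unfold cutCoord
  rw [Real.smoothTransition.one_of_one_le (by linarith), Real.smoothTransition.one_of_one_le,
    one_mul, mul_one]
  rw [← div_lt_one hm] at h4
  linarith

/-- The bound does not depend on `M`. The derivative of the first cutoff is of order `M |v| |Dv|`
and lives where `1 ≤ M |v|² ≤ 2`, so the extra factor `|v|`, the square root of the weight, turns it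
into a multiple of `|Dv|`. -/
lemma norm_fderiv_mul_smoothTransition_mul_le {E : Type*} [NormedAddCommGroup E]
    [InnerProductSpace ℝ E] {L : ℝ} (hL0 : 0 ≤ L) (hL : ∀ t, |deriv Real.smoothTransition t| ≤ L)
    {ℓ : E →L[ℝ] ℝ} (hℓ : ‖ℓ‖ ≤ 1) {v : E → ℂ} (hv : Differentiable ℝ v) {M : ℝ} (hM1 : 1 ≤ M)
    (x : E) :
    ‖fderiv ℝ (fun y => ℓ y * (Real.smoothTransition (M * ‖v y‖ ^ 2 - 1) *
      Real.smoothTransition (2 - ‖y‖ ^ 2 / M))) x‖ * ‖v x‖ ≤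
      ‖v x‖ + ‖x‖ * (4 * L * ‖fderiv ℝ v x‖ + 2 * L * ‖x‖ * ‖v x‖) := by
  have hℓx : |ℓ x| ≤ ‖x‖ := by
    simpa using (ℓ.le_opNorm x).trans (mul_le_of_le_one_left (norm_nonneg x) hℓ)
  have hM0 : 0 < M := by linarith
  set V : ℂ := v x with hV
  set DV := fderiv ℝ v x with hDV
  have hd : ∀ t, HasDerivAt Real.smoothTransition (deriv Real.smoothTransition t) t := fun t =>
    ((Real.smoothTransition.contDiff (n := 1)).differentiable one_ne_zero t).hasDerivAt
  have hVd : HasFDerivAt v DV x := (hv x).hasFDerivAt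
  set E₁ : E →L[ℝ] ℝ := (2 : ℝ) • (innerSL ℝ V).comp DV with hE₁
  set E₂ : E →L[ℝ] ℝ := (2 : ℝ) • innerSL ℝ x with hE₂
  have b1 : HasFDerivAt (fun y : E => ‖v y‖ ^ 2) E₁ x := by
    convert! hVd.norm_sq using 1
    rw [hE₁, two_smul, two_nsmul]
  have b2 : HasFDerivAt (fun y : E => ‖y‖ ^ 2) E₂ x := by
    convert! (hasStrictFDerivAt_norm_sq x).hasFDerivAt using 1
    rw [hE₂, two_smul, two_nsmul]
  have c1 : ‖E₁‖ ≤ 2 * (‖V‖ * ‖DV‖) := by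
    rw [hE₁, norm_smul, Real.norm_ofNat]
    refine mul_le_mul_of_nonneg_left ((ContinuousLinearMap.opNorm_comp_le _ _).trans ?_) zero_le_two
    rw [innerSL_apply_norm]
  have c2 : ‖E₂‖ = 2 * ‖x‖ := by
    rw [hE₂, norm_smul, Real.norm_ofNat, innerSL_apply_norm]
  set α := Real.smoothTransition (M * ‖V‖ ^ 2 - 1) with hα
  set α' := deriv Real.smoothTransition (M * ‖V‖ ^ 2 - 1) with hα'
  set β := Real.smoothTransition (2 - ‖x‖ ^ 2 / M) with hβ
  set β' := deriv Real.smoothTransition (2 - ‖x‖ ^ 2 / M) with hβ'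
  have a1 : HasFDerivAt (fun y : E =>
      Real.smoothTransition (M * ‖v y‖ ^ 2 - 1)) (α' • (M • E₁)) x :=
    HasDerivAt.comp_hasFDerivAt (h₂ := Real.smoothTransition) x (hd (M * ‖V‖ ^ 2 - 1)) ((b1.const_mul M).sub_const 1)
  have a2 : HasFDerivAt (fun y : E =>
      Real.smoothTransition (2 - ‖y‖ ^ 2 / M)) (β' • (-(M⁻¹ • E₂))) x := by
    have h : HasFDerivAt (fun y : E => 2 - ‖y‖ ^ 2 / M) (-(M⁻¹ • E₂)) x := by
      simp_rw [div_eq_mul_inv]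
      exact (b2.mul_const M⁻¹).const_sub 2
    exact HasDerivAt.comp_hasFDerivAt (h₂ := Real.smoothTransition) x (hd (2 - ‖x‖ ^ 2 / M)) h
  have a3 : HasFDerivAt (fun y => ℓ y * (Real.smoothTransition (M * ‖v y‖ ^ 2 - 1) *
      Real.smoothTransition (2 - ‖y‖ ^ 2 / M)))
      (ℓ x • (α • (β' • (-(M⁻¹ • E₂))) + β • (α' • (M • E₁))) +
        (α * β) • ℓ) x :=
    (ℓ).hasFDerivAt.mul (a1.mul a2)
  rw [a3.fderiv]
  have hα0 : 0 ≤ α := Real.smoothTransition.nonneg _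
  have hα1 : α ≤ 1 := Real.smoothTransition.le_one _
  have hβ0 : 0 ≤ β := Real.smoothTransition.nonneg _
  have hβ1 : β ≤ 1 := Real.smoothTransition.le_one _
  have hM' : M⁻¹ ≤ 1 := inv_le_one_of_one_le₀ hM1
  have d1 : ‖(α * β) • ℓ‖ ≤ 1 := by
    rw [norm_smul, Real.norm_of_nonneg (mul_nonneg hα0 hβ0)]
    exact mul_le_one₀ (mul_le_one₀ hα1 hβ0 hβ1) (norm_nonneg _) (hℓ)
  have d2 : ‖α • (β' • (-(M⁻¹ • E₂)))‖ ≤ 2 * L * ‖x‖ := by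
    rw [norm_smul, norm_smul, norm_neg, norm_smul, c2, Real.norm_of_nonneg hα0, Real.norm_eq_abs,
      Real.norm_of_nonneg (inv_nonneg.2 hM0.le)]
    calc α * (|β'| * (M⁻¹ * (2 * ‖x‖))) ≤ 1 * (L * (1 * (2 * ‖x‖))) := by
          gcongr
          exact hL _
      _ = _ := by ring
  -- Outside the transition zone `M |V|² - 1 ∈ [0, 1]` the derivative `α'` vanishes; inside it `M
  -- |V|² ≤ 2`.
  have d3 : |α'| * (M * ‖V‖ ^ 2) ≤ 2 * L := by
    by_cases h : M * ‖V‖ ^ 2 - 1 ∈ Set.Icc (0 : ℝ) 1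
    · calc |α'| * (M * ‖V‖ ^ 2) ≤ L * 2 := by
            gcongr
            · exact hL _
            · linarith [h.2]
        _ = _ := by ring
    · rw [hα', deriv_smoothTransition_of_notMem h]
      simpa using hL0
  have d4 : ‖β • (α' • (M • E₁))‖ * ‖V‖ ≤ 4 * L * ‖DV‖ := by
    rw [norm_smul, norm_smul, norm_smul, Real.norm_of_nonneg hβ0, Real.norm_eq_abs,
      Real.norm_of_nonneg hM0.le]
    calc β * (|α'| * (M * ‖E₁‖)) * ‖V‖ ≤ 1 * (|α'| * (M * (2 * (‖V‖ * ‖DV‖)))) * ‖V‖ := by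
          gcongr
      _ = 2 * (|α'| * (M * ‖V‖ ^ 2)) * ‖DV‖ := by ring
      _ ≤ 2 * (2 * L) * ‖DV‖ := by gcongr
      _ = _ := by ring
  calc _ ≤ (|ℓ x| * (‖α • (β' • (-(M⁻¹ • E₂)))‖ + ‖β • (α' • (M • E₁))‖) + 1) * ‖V‖ := by
        gcongr
        refine (norm_add_le _ _).trans (add_le_add ?_ d1)
        rw [norm_smul, Real.norm_eq_abs]
        gcongr
        exact norm_add_le _ _
    _ = ‖V‖ + |ℓ x| * (‖β • (α' • (M • E₁))‖ * ‖V‖ +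
          ‖α • (β' • (-(M⁻¹ • E₂)))‖ * ‖V‖) := by ring
    _ ≤ _ := by
        gcongr

lemma norm_fderiv_cutCoord_mul_le {L : ℝ} (hL0 : 0 ≤ L)
    (hL : ∀ t, |deriv Real.smoothTransition t| ≤ L) (n m : ℕ) (x : Config (n + 1)) :
    ‖fderiv ℝ (cutCoord n m) x‖ * ‖configVandermonde x‖ ≤
      ‖configVandermonde x‖ + ‖x‖ * (4 * L * ‖fderiv ℝ configVandermonde x‖ +
        2 * L * ‖x‖ * ‖configVandermonde x‖) :=
  norm_fderiv_mul_smoothTransition_mul_le hL0 hL (norm_firstCoord_le n)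
    ((contDiff_configVandermonde n).differentiable (by simp))
    (by linarith [(Nat.cast_nonneg m : (0 : ℝ) ≤ m)]) x

/-- A single dominating function, polynomial times Gaussian, serves both the energies of all the
cutoffs and the first moment. -/
lemma exists_norm_fderiv_cutCoord_sq_mul_le (n : ℕ) : ∃ g : Config (n + 1) → ℝ, Integrable g ∧
    (∀ m x, ‖fderiv ℝ (cutCoord n m) x‖ ^ 2 * configDensity n x ≤ g x) ∧
    ∀ x, ‖x‖ * configDensity n x ≤ g x := by
  obtain ⟨L, hL0, hL⟩ := exists_abs_deriv_smoothTransition_le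
  obtain ⟨k, C, hC, h1, h2⟩ := exists_configVandermonde_growth n
  set B : Config (n + 1) → ℝ := fun x => C * (1 + 6 * L) * (1 + ‖x‖) ^ (k + 2) with hB
  refine ⟨fun x => (C * (1 + 6 * L)) ^ 2 * ((1 + ‖x‖) ^ (2 * k + 4) *
    Real.exp (-((n : ℝ) + 1) * ‖x‖ ^ 2)),
    (integrable_one_add_norm_pow_mul_exp _ (by positivity)).const_mul _, fun m x => ?_, fun x => ?_⟩
  · have h3 := norm_fderiv_cutCoord_mul_le hL0 hL n m x
    have h4 : ‖fderiv ℝ (cutCoord n m) x‖ * ‖configVandermonde x‖ ≤ B x := by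
      refine h3.trans ?_
      have hx := norm_nonneg x
      calc _ ≤ C * (1 + ‖x‖) ^ k + ‖x‖ * (4 * L * (C * (1 + ‖x‖) ^ k) +
            2 * L * ‖x‖ * (C * (1 + ‖x‖) ^ k)) := by
            gcongr
            exacts [h1 x, h2 x, h1 x]
        _ = C * (1 + ‖x‖) ^ k * (1 + 4 * L * ‖x‖ + 2 * L * ‖x‖ ^ 2) := by ring
        _ ≤ C * (1 + ‖x‖) ^ k * ((1 + 6 * L) * (1 + ‖x‖) ^ 2) := by
            gcongr
            nlinarith [mul_nonneg hL0 hx, mul_nonneg hL0 (sq_nonneg ‖x‖)]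
        _ = _ := by rw [hB]; ring
    calc _ = (‖fderiv ℝ (cutCoord n m) x‖ * ‖configVandermonde x‖) ^ 2 *
          Real.exp (-((n : ℝ) + 1) * ‖x‖ ^ 2) := by rw [configDensity_eq]; ring
      _ ≤ B x ^ 2 * Real.exp (-((n : ℝ) + 1) * ‖x‖ ^ 2) := by gcongr
      _ = _ := by rw [hB]; ring
  · have hx := norm_nonneg x
    calc _ = ‖configVandermonde x‖ ^ 2 * ‖x‖ * Real.exp (-((n : ℝ) + 1) * ‖x‖ ^ 2) := by
          rw [configDensity_eq]; ring
      _ ≤ (C * (1 + ‖x‖) ^ k) ^ 2 * (1 + ‖x‖) ^ 4 * Real.exp (-((n : ℝ) + 1) * ‖x‖ ^ 2) := by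
          gcongr
          · exact h1 x
          · have : 1 ≤ (1 + ‖x‖) ^ 3 := one_le_pow₀ (by linarith)
            nlinarith
      _ ≤ ((C * (1 + 6 * L)) * (1 + ‖x‖) ^ k) ^ 2 * (1 + ‖x‖) ^ 4 *
            Real.exp (-((n : ℝ) + 1) * ‖x‖ ^ 2) := by
          gcongr
          exact le_mul_of_one_le_right hC (by linarith)
      _ = _ := by ring

end Cutoff

/-! ### Lower bound on the Poincaré constant of the Gibbs measure -/

section LowerBound

open Filter Topology

lemma gibbsMeasure_eq (n : ℕ) : gibbsMeasure (n + 1) (((n + 1 : ℕ) : ℝ) ^ 2) =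
    (partitionFunction (n + 1) (((n + 1 : ℕ) : ℝ) ^ 2))⁻¹ •
      volume.withDensity fun x => ENNReal.ofReal (configDensity n x) := by
  rw [gibbsMeasure, gibbsWeight_eq]

lemma ae_gibbsMeasure_configVandermonde_ne_zero (n : ℕ) :
    ∀ᵐ x ∂(gibbsMeasure (n + 1) (((n + 1 : ℕ) : ℝ) ^ 2)), configVandermonde x ≠ 0 := by
  rw [gibbsMeasure_eq]
  refine Measure.ae_smul_measure ?_ _
  rw [ae_withDensity_iff (continuous_configDensity n).measurable.ennreal_ofReal]
  refine Eventually.of_forall fun x hx h => hx ?_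
  rw [configDensity_eq, h]
  simp

lemma integrable_norm_gibbsMeasure (n : ℕ) :
    Integrable (fun x => ‖x‖) (gibbsMeasure (n + 1) (((n + 1 : ℕ) : ℝ) ^ 2)) := by
  rw [gibbsMeasure_eq]
  refine Integrable.smul_measure ?_ (ENNReal.inv_ne_top.2 (partitionFunction_ne_zero n))
  have hcd := continuous_configDensity n
  rw [integrable_withDensity_iff hcd.measurable.ennreal_ofReal
    (Eventually.of_forall fun x => ENNReal.ofReal_lt_top)]
  obtain ⟨g, hg, -, h⟩ := exists_norm_fderiv_cutCoord_sq_mul_le n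
  simp_rw [fun x => ENNReal.toReal_ofReal (configDensity_nonneg n x)]
  refine hg.mono' (by fun_prop) (Eventually.of_forall fun x => ?_)
  rw [Real.norm_of_nonneg (mul_nonneg (norm_nonneg _) (configDensity_nonneg n x))]
  exact h x

lemma fderiv_eq_of_eventuallyEq {E : Type*} [NormedAddCommGroup E] [NormedSpace ℝ E]
    {f : E → ℝ} {ℓ : E →L[ℝ] ℝ} {x : E} (h : f =ᶠ[𝓝 x] ℓ) : fderiv ℝ f x = ℓ :=
  (ℓ.hasFDerivAt.congr_of_eventuallyEq h).fderiv

lemma enorm_gradient_eq {E : Type*} [NormedAddCommGroup E] [InnerProductSpace ℝ E]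
    [CompleteSpace E] (f : E → ℝ) (x : E) : ‖gradient f x‖ₑ = ‖fderiv ℝ f x‖ₑ := by
  unfold gradient
  exact LinearIsometryEquiv.enorm_map _ _

/-- Off the collisions the cut-off function eventually coincides with the linear form near each
point; at collisions the density is zero. Domination then gives convergence of the energies. -/
lemma tendsto_lintegral_gradient_cutCoord (n : ℕ) :
    Tendsto (fun m => ∫⁻ x, ‖gradient (cutCoord n m) x‖ₑ ^ 2
      ∂(gibbsMeasure (n + 1) (((n + 1 : ℕ) : ℝ) ^ 2))) atTop (𝓝 (‖firstCoord n‖ₑ ^ 2)) := by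
  have hcd := continuous_configDensity n
  have hfc : ∀ m, Continuous (fderiv ℝ (cutCoord n m)) := fun m =>
    (contDiff_cutCoord n m).continuous_fderiv (by simp)
  have hmeas : ∀ m, Measurable fun x => ‖fderiv ℝ (cutCoord n m) x‖ₑ ^ 2 := fun m =>
    (continuous_enorm.comp (hfc m)).measurable.pow_const 2
  obtain ⟨g, hg, hg1, -⟩ := exists_norm_fderiv_cutCoord_sq_mul_le n
  have key : Tendsto (fun m => ∫⁻ x, ENNReal.ofReal (configDensity n x) *
      ‖fderiv ℝ (cutCoord n m) x‖ₑ ^ 2) atTop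
      (𝓝 (∫⁻ x, ENNReal.ofReal (configDensity n x) * ‖firstCoord n‖ₑ ^ 2)) := by
    refine tendsto_lintegral_of_dominated_convergence (fun x => ENNReal.ofReal (g x))
      (fun m => ?_) (fun m => ?_) ?_ ?_
    · exact hcd.measurable.ennreal_ofReal.mul (hmeas m)
    · refine Eventually.of_forall fun x => ?_
      have : ENNReal.ofReal (configDensity n x) * ‖fderiv ℝ (cutCoord n m) x‖ₑ ^ 2 =
          ENNReal.ofReal (‖fderiv ℝ (cutCoord n m) x‖ ^ 2 * configDensity n x) := by
        rw [ENNReal.ofReal_mul (sq_nonneg _), ENNReal.ofReal_pow (norm_nonneg _), ofReal_norm,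
          mul_comm]
      simp only [this]
      exact ENNReal.ofReal_le_ofReal (hg1 m x)
    · exact hg.lintegral_lt_top.ne
    · refine Eventually.of_forall fun x => ?_
      by_cases hx : configVandermonde x = 0
      · simp [configDensity_eq, hx]
      · refine tendsto_const_nhds.congr' ?_
        filter_upwards [eventually_cutCoord_eventuallyEq hx] with m hm
        rw [fderiv_eq_of_eventuallyEq hm]
  have h1 : ∀ h : Config (n + 1) → ℝ≥0∞, Measurable h →
      ∫⁻ x, h x ∂(gibbsMeasure (n + 1) (((n + 1 : ℕ) : ℝ) ^ 2)) =
      (partitionFunction (n + 1) (((n + 1 : ℕ) : ℝ) ^ 2))⁻¹ *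
        ∫⁻ x, ENNReal.ofReal (configDensity n x) * h x := fun h hh => by
    rw [gibbsMeasure_eq, lintegral_smul_measure, smul_eq_mul,
      lintegral_withDensity_eq_lintegral_mul _ hcd.measurable.ennreal_ofReal hh]
    rfl
  have h2 : ‖firstCoord n‖ₑ ^ 2 =
      ∫⁻ _, ‖firstCoord n‖ₑ ^ 2 ∂(gibbsMeasure (n + 1) (((n + 1 : ℕ) : ℝ) ^ 2)) := by
    rw [lintegral_const, measure_univ, mul_one]
  rw [h2, h1 _ measurable_const]
  simp_rw [enorm_gradient_eq]
  have h3 := fun m => h1 (fun x => ‖fderiv ℝ (cutCoord n m) x‖ₑ ^ 2) (hmeas m)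
  simp_rw [h3]
  exact ENNReal.Tendsto.const_mul key (Or.inr (ENNReal.inv_ne_top.2 (partitionFunction_ne_zero n)))

/-- The mean square distance of the first coordinate to any constant is bounded below,
uniformly in the number of particles. -/
lemma le_lintegral_firstCoord_sub_sq (n : ℕ) (a : ℝ) : ENNReal.ofReal (1 / 512) ≤
    ∫⁻ x, ENNReal.ofReal ((firstCoord n x - a) ^ 2)
      ∂(gibbsMeasure (n + 1) (((n + 1 : ℕ) : ℝ) ^ 2)) := by
  have hm0 : Measurable fun x : Config (n + 1) => x 0 := by fun_prop
  have hpc := continuous_profile n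
  have hcoord : ∀ p : ℝ × ℝ, prodToPlane p 0 = p.1 := fun p => by
    have : prodToPlane p = Complex.orthonormalBasisOneI.repr (Complex.equivRealProdCLM.symm p) := rfl
    rw [this, Complex.orthonormalBasisOneI_repr_apply]
    simp
  have h1 : ∫⁻ x, ENNReal.ofReal ((firstCoord n x - a) ^ 2)
      ∂(gibbsMeasure (n + 1) (((n + 1 : ℕ) : ℝ) ^ 2)) = (ENNReal.ofReal Real.pi)⁻¹ *
        ∫⁻ p : ℝ × ℝ, ENNReal.ofReal (profile n (p.1 ^ 2 + p.2 ^ 2) * (p.1 - a) ^ 2) := by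
    have e1 : ∫⁻ x, ENNReal.ofReal ((firstCoord n x - a) ^ 2)
      ∂(gibbsMeasure (n + 1) (((n + 1 : ℕ) : ℝ) ^ 2)) = ∫⁻ z : Plane, ENNReal.ofReal ((z 0 - a) ^ 2)
        ∂(oneParticleMarginal (n + 1) (((n + 1 : ℕ) : ℝ) ^ 2)) := by
      unfold oneParticleMarginal
      rw [lintegral_map (by fun_prop) hm0]
      rfl
    rw [e1, oneParticleMarginal_eq, lintegral_smul_measure, smul_eq_mul, profileMeasure,
      lintegral_withDensity_eq_lintegral_mul _ (by fun_prop) (by fun_prop),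
      ← measurePreserving_prodToPlane.lintegral_comp_emb
        prodToPlane.toHomeomorph.measurableEmbedding]
    congr 1
    refine lintegral_congr fun p => ?_
    rw [Pi.mul_apply, hcoord, norm_prodToPlane_sq,
      ENNReal.ofReal_mul (profile_nonneg n (by positivity))]
  -- Of the strips `[-1/2, -1/4]` and `[1/4, 1/2]`, the one on the side opposite to `a` is at
  -- distance at least `1/4` from it. With area `1/4` and profile at least `1/2` this gives `1/128`,
  -- and `π ≤ 4` gives `1/512`.
  obtain ⟨b, hb, hab⟩ : ∃ b : ℝ, (b = -(1 / 2) ∨ b = 1 / 4) ∧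
      ∀ t ∈ Set.Icc b (b + 1 / 4), 1 / 16 ≤ (t - a) ^ 2 := by
    rcases le_total a 0 with h | h
    · exact ⟨1 / 4, Or.inr rfl, fun t ht => by nlinarith [ht.1]⟩
    · exact ⟨-(1 / 2), Or.inl rfl, fun t ht => by nlinarith [ht.2]⟩
  have hvol : volume (Set.Icc b (b + 1 / 4) ×ˢ unitInt) = ENNReal.ofReal (1 / 4) := by
    rw [Measure.volume_eq_prod, Measure.prod_prod, volume_unitInt, mul_one, Real.volume_Icc]
    congr 1; ring
  have h2 : ENNReal.ofReal (1 / 128) ≤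
      ∫⁻ p : ℝ × ℝ, ENNReal.ofReal (profile n (p.1 ^ 2 + p.2 ^ 2) * (p.1 - a) ^ 2) := by
    calc ENNReal.ofReal (1 / 128) =
          ∫⁻ _ in Set.Icc b (b + 1 / 4) ×ˢ unitInt, ENNReal.ofReal (1 / 32) := by
          rw [setLIntegral_const, hvol, ← ENNReal.ofReal_mul (by norm_num)]
          congr 1; norm_num
      _ ≤ ∫⁻ p in Set.Icc b (b + 1 / 4) ×ˢ unitInt,
            ENNReal.ofReal (profile n (p.1 ^ 2 + p.2 ^ 2) * (p.1 - a) ^ 2) := by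
          refine setLIntegral_mono' (measurableSet_Icc.prod measurableSet_Icc) fun p hp => ?_
          refine ENNReal.ofReal_le_ofReal ?_
          have e1 := hab p.1 hp.1
          have e2 : p.1 ^ 2 ≤ 1 / 4 := by
            rcases hb with rfl | rfl <;> nlinarith [hp.1.1, hp.1.2]
          have e3 : p.2 ^ 2 ≤ 1 / 4 := by nlinarith [hp.2.1, hp.2.2]
          have e4 := half_le_profile n (s := p.1 ^ 2 + p.2 ^ 2) (by positivity) (by linarith)
          calc (1 / 32 : ℝ) = 1 / 2 * (1 / 16) := by norm_num
            _ ≤ _ := by gcongr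
      _ ≤ _ := setLIntegral_le_lintegral _ _
  rw [h1, ← ENNReal.ofReal_inv_of_pos Real.pi_pos]
  calc ENNReal.ofReal (1 / 512) = ENNReal.ofReal (1 / 4) * ENNReal.ofReal (1 / 128) := by
        rw [← ENNReal.ofReal_mul (by norm_num)]; congr 1; norm_num
    _ ≤ _ := by
        refine mul_le_mul' (ENNReal.ofReal_le_ofReal ?_) h2
        rw [one_div]
        exact inv_anti₀ Real.pi_pos Real.pi_le_four

theorem le_bestPoincareConstant_gibbsMeasure (n : ℕ) : ENNReal.ofReal (1 / 512) ≤
    bestPoincareConstant (gibbsMeasure (n + 1) (((n + 1 : ℕ) : ℝ) ^ 2))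
      (smoothCompactlySupportedIn (distinctConfigs (n + 1))) := by
  set μ := gibbsMeasure (n + 1) (((n + 1 : ℕ) : ℝ) ^ 2) with hμ
  refine le_iInf₂ fun c hc => ?_
  have hlim : ∀ᵐ x ∂μ, Tendsto (fun m => cutCoord n m x) atTop (𝓝 (firstCoord n x)) := by
    filter_upwards [ae_gibbsMeasure_configVandermonde_ne_zero n] with x hx
    refine tendsto_const_nhds.congr' ?_
    filter_upwards [eventually_cutCoord_eventuallyEq hx] with m hm
    exact hm.eq_of_nhds.symm
  have hcont : ∀ m, Continuous (cutCoord n m) := fun m => (contDiff_cutCoord n m).continuous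
  have hmean : Tendsto (fun m => ∫ x, cutCoord n m x ∂μ) atTop (𝓝 (∫ x, firstCoord n x ∂μ)) :=
    tendsto_integral_of_dominated_convergence (fun x => ‖x‖)
      (fun m => (hcont m).aestronglyMeasurable) (integrable_norm_gibbsMeasure n)
      (fun m => Eventually.of_forall fun x => abs_cutCoord_le m x) hlim
  set a := ∫ x, firstCoord n x ∂μ
  calc ENNReal.ofReal (1 / 512) ≤ ∫⁻ x, ENNReal.ofReal ((firstCoord n x - a) ^ 2) ∂μ :=
        le_lintegral_firstCoord_sub_sq n a
    _ = ∫⁻ x, liminf (fun m => ENNReal.ofReal ((cutCoord n m x - ∫ y, cutCoord n m y ∂μ) ^ 2))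
          atTop ∂μ := by
        refine lintegral_congr_ae ?_
        filter_upwards [hlim] with x hx
        exact (Tendsto.liminf_eq (ENNReal.tendsto_ofReal ((hx.sub hmean).pow 2))).symm
    -- Fatou's lemma: only lower semicontinuity of the variance is needed.
    _ ≤ liminf (fun m => ∫⁻ x, ENNReal.ofReal ((cutCoord n m x - ∫ y, cutCoord n m y ∂μ) ^ 2) ∂μ)
          atTop := lintegral_liminf_le fun m => by have := hcont m; fun_prop
    _ ≤ liminf (fun m => c * ∫⁻ x, ‖gradient (cutCoord n m) x‖ₑ ^ 2 ∂μ) atTop := by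
        refine liminf_le_liminf (Eventually.of_forall fun m => ?_)
        simp only [← ProbabilityTheory.evariance_eq_lintegral_ofReal]
        exact hc.2 _ (cutCoord_mem n m)
    _ = c * ‖firstCoord n‖ₑ ^ 2 := Tendsto.liminf_eq
        (ENNReal.Tendsto.const_mul (tendsto_lintegral_gradient_cutCoord n)
          (Or.inr ENNReal.coe_ne_top))
    _ ≤ c := by
        refine mul_le_of_le_one_right' (pow_le_one' ?_ 2)
        rw [← ofReal_norm, ENNReal.ofReal_le_one]
        exact norm_firstCoord_le n

end LowerBound

end CoulombGas

theorem theorem1p4 :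
    (∃ c : ℝ≥0, ∀ (N : ℕ) [NeZero N],
      CoulombGas.PoincareInequality (CoulombGas.oneParticleMarginal N ((N : ℝ) ^ 2))
        (CoulombGas.smoothFunctions CoulombGas.Plane) c) ∧
    (∃ c₀ : ℝ≥0, 0 < c₀ ∧ ∀ (N : ℕ) [NeZero N],
      (c₀ : ℝ≥0∞) ≤ CoulombGas.bestPoincareConstant (CoulombGas.gibbsMeasure N ((N : ℝ) ^ 2))
        (CoulombGas.smoothCompactlySupportedIn (CoulombGas.distinctConfigs N))) := by
  refine ⟨⟨4096386000, fun N hN => ?_⟩, ⟨Real.toNNReal (1 / 512), by simp, fun N hN => ?_⟩⟩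
  · obtain ⟨n, rfl⟩ := Nat.exists_eq_succ_of_ne_zero hN.ne
    exact CoulombGas.poincareInequality_oneParticleMarginal n
  · obtain ⟨n, rfl⟩ := Nat.exists_eq_succ_of_ne_zero hN.ne
    exact CoulombGas.le_bestPoincareConstant_gibbsMeasure n
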